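/- **Setting.** Let $L, r>0$, and let sensors of range $r$ lie initially at points $0\le x_1\le\dots\le x_n$ of the barrier $[0,L]$, where a sensor at $x$ covers $[x-r,x+r]$. Assume $2rn\ge L$ and that the endpoint $L$ is uncovered ($x_i+r<L$ for all $i$). A robot starts at $0$, walks on $[0,L]$, and may pick up, carry (any number of) and deposit sensors anywhere on $[0,L]$; it *restores coverage* if at the end the sensors lying on the barrier cover $[0,L]$. Its cost is the length of its trajectory. For an input $I$, let $T_o(I)$ be the infimum of the costs of all robot plans that restore coverage on $I$. An *online algorithm (known length)* is a rule that assigns to each input $I$ a plan which restores coverage on $I$, such that the robot knows $L$ and $r$ but learns of the sensors at a point only on reaching it: if two inputs with the same $L,r$ have the same sensors in $[0,y]$, the robot acts identically on both as long as it stays in $[0,y]$. Let $T_A(I)$ be the cost of algorithm $A$ on $I$. **The algorithm AdaptiveOnline.** Let $C_i=(2ri-r)-x_i$ be the coverage balance of sensor $i$, and let $2ri-r$ be its *attached position* (replaced by $L-r$ if it exceeds $L-r$). Sensor $i$ is a *potential left-turning point* if $-2r<C_i<0$, or if $C_i=-2r$ and $x_{i+1}=x_i$. *Walking in surplus*, after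 the sensors $1,\dots,k$ have been dealt with, means walking right, picking up sensors and depositing them at their attached positions, until reaching the attached position $x=x_m+C_m$ of the first sensor $m>k$ with $C_m<0$ (the robot has then run out of sensors, with a gap starting at $x-r$), or, if there is no such $m$, until the end, where it stops at $L-r$ with the barrier covered. The algorithm first walks in surplus from $0$ (so $x=r$ at once if $0$ is uncovered). If this stops at some $x$, it starts an *epoch* at $t=x-r$ with $T=0$, and repeats the following. Let $b=x$ be the current position. Walk right, picking up all sensors, to the first potential left-turning point $a>b$, and set $T\leftarrow T+r+3(a-b)$. * If $T-(a-t)>L-t$: make a final double, i.e. walk on to $L-r$ picking up all sensors, walk back to $b$ depositing sensors at their attached positions, and stop. * Otherwise: make a triple, i.e. walk back to $b$ depositing the collected sensors at their attached positions, and return to $a$. Then walk in surplus. If the end of the barrier is reached, stop. Otherwise, with $x$ the new position, set $T\leftarrow T+(x-r-a)$. If $T/(x-r-t)\le 5/2$, start a new epoch ($t\leftarrow x-r$, $T\leftarrow 0$). Repeat. **Theorem.** AdaptiveOnline is an online algorithm for barrier coverage of a segment of known length, it satisfies $$T_{\mathrm{AdaptiveOnline}}(I)\;\le\;\tfrac54\,T_o(I)+\tfrac34\,r\qquad\text{for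 every input } I,$$ so that (as $T_o(I)\ge L-r$) its competitive ratio is at most $\frac54+\frac{3r}{4(L-r)}$, which tends to $\frac54$ as $r/L\to0$; and it is optimal in this respect: for every online algorithm $A$ and all $\varepsilon,\delta>0$ there is an input $I$ with $r\le\delta L$ and $T_A(I)\ge(\frac54-\varepsilon)\,T_o(I)$. -/

import Mathlib

noncomputable section

namespace BarrierCoverage

/-- An input: the barrier `[0, L]`, the common sensing range `r`, and the initial positions of the
sensors in nondecreasing order. The sensors suffice to cover the barrier, and the endpoint `L` is
initially uncovered. -/
structure Inst where
  L : ℝ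
  r : ℝ
  sensors : List ℝ
  L_pos : 0 < L
  r_pos : 0 < r
  sorted : sensors.Pairwise (· ≤ ·)
  nonneg : ∀ x ∈ sensors, 0 ≤ x
  end_uncovered : ∀ x ∈ sensors, x + r < L
  enough : L ≤ 2 * r * sensors.length

/-! ### Robot plans -/

/-- What the robot does on arrival: nothing, pick up one sensor, or deposit one sensor. -/
inductive Task where
  | pass
  | pick
  | drop

/-- The robot walks straight to `dest` and there performs `task`. -/
structure Leg where
  dest : ℝ
  task : Task

/-- The number of sensors carried by the robot, and the sensors lying on the barrier. -/
structure State where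
  carried : ℕ
  ground : Multiset ℝ

/-- Executability and effect of one leg on the barrier `[0, L]`. -/
inductive Step (L : ℝ) : State → Leg → State → Prop
  | pass (p : ℝ) (c : ℕ) (g : Multiset ℝ) (h0 : 0 ≤ p) (hL : p ≤ L) :
      Step L ⟨c, g⟩ ⟨p, Task.pass⟩ ⟨c, g⟩
  | pick (p : ℝ) (c : ℕ) (g : Multiset ℝ) (h0 : 0 ≤ p) (hL : p ≤ L) :
      Step L ⟨c, p ::ₘ g⟩ ⟨p, Task.pick⟩ ⟨c + 1, g⟩
  | drop (p : ℝ) (c : ℕ) (g : Multiset ℝ) (h0 : 0 ≤ p) (hL : p ≤ L) :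
      Step L ⟨c + 1, g⟩ ⟨p, Task.drop⟩ ⟨c, p ::ₘ g⟩

/-- Executability and effect of a list of legs. -/
inductive Run (L : ℝ) : State → List Leg → State → Prop
  | nil (s : State) : Run L s [] s
  | cons (s s' s'' : State) (l : Leg) (ls : List Leg) :
      Step L s l s' → Run L s' ls s'' → Run L s (l :: ls) s''

/-- The sensors at the positions in `g`, of range `r`, cover all of `[0, L]`. -/
def Covers (L r : ℝ) (g : Multiset ℝ) : Prop :=
  ∀ z : ℝ, 0 ≤ z → z ≤ L → ∃ s ∈ g, s - r ≤ z ∧ z ≤ s + r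

/-- The plan can be executed on the input `I` (starting without carried sensors), and the sensors
lying on the barrier at its end provide complete coverage. -/
def RestoresCoverage (I : Inst) (plan : List Leg) : Prop :=
  ∃ s : State, Run I.L ⟨0, (I.sensors : Multiset ℝ)⟩ plan s ∧ Covers I.L I.r s.ground

/-- The length of the trajectory of a robot that starts at `q`. -/
def lengthFrom : ℝ → List Leg → ℝ
  | _, [] => 0
  | q, l :: ls => |l.dest - q| + lengthFrom l.dest ls

/-- The length of the trajectory of a plan; the robot starts at `0`. -/
def trajLength (plan : List Leg) : ℝ := lengthFrom 0 plan

/-- The length of an optimal offline trajectory. -/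
def optLength (I : Inst) : ℝ :=
  sInf {T : ℝ | ∃ plan : List Leg, RestoresCoverage I plan ∧ T = trajLength plan}

/-! ### Online algorithms knowing the barrier length -/

/-- The behaviour of the robot depends only on `L`, `r` and the sensors met so far: if two inputs
with the same `L` and `r` have the same sensors in `[0, y]`, then the robot behaves identically on
both as long as it stays in `[0, y]`. -/
def NonAnticipating (A : Inst → List Leg) : Prop :=
  ∀ (I J : Inst) (y : ℝ), I.L = J.L → I.r = J.r →
    I.sensors.filter (fun x => decide (x ≤ y)) = J.sensors.filter (fun x => decide (x ≤ y)) →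
    ∀ p : List Leg, p <+: A I → (∀ l ∈ p, l.dest ≤ y) → p <+: A J

/-- An online algorithm for barrier coverage of a segment of known length. -/
def IsOnlineAlgorithm (A : Inst → List Leg) : Prop :=
  NonAnticipating A ∧ ∀ I : Inst, RestoresCoverage I (A I)

/-! ### The algorithm AdaptiveOnline

Sensors are indexed from `0`. -/

namespace Inst

variable (I : Inst)

/-- The position of sensor `i`. -/
def pos (i : ℕ) : ℝ := I.sensors.getD i 0

/-- The attached position `2 r i + r` of sensor `i` in a fully stretched solution. -/
def spot (i : ℕ) : ℝ := 2 * I.r * i + I.r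

/-- Where sensor `i` is deposited: at its attached position, except that the last sensor that is
needed is deposited at `L - r` if its attached position is beyond. -/
def slot (i : ℕ) : ℝ := min (I.spot i) (I.L - I.r)

/-- The number of sensors needed to cover `[0, L]`. -/
def needed : ℕ := ⌈I.L / (2 * I.r)⌉₊

/-- The coverage balance of sensor `i`. -/
def balance (i : ℕ) : ℝ := I.spot i - I.pos i

/-- Sensor `i` is a potential left-turning point. -/
def LeftTurn (i : ℕ) : Prop :=
  (-(2 * I.r) < I.balance i ∧ I.balance i < 0) ∨
    (I.balance i = -(2 * I.r) ∧ i + 1 < I.sensors.length ∧ I.pos (i + 1) = I.pos i)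

/-- The first sensor with index at least `k` and negative coverage balance. A robot that moves
right in surplus, having dealt with the sensors before `k`, runs out of sensors exactly at the
attached position of this sensor; with `none` it reaches the end of the barrier in surplus. -/
def firstDeficit (k : ℕ) : Option ℕ :=
  (List.range' k (I.sensors.length - k)).find? (fun i => decide (I.balance i < 0))

open Classical in
/-- The first potential left-turning point with index at least `k`. -/
def firstLeftTurn (k : ℕ) : Option ℕ :=
  (List.range' k (I.sensors.length - k)).find? (fun i => decide (I.LeftTurn i))

/-- Walk over the sensors `k, …, m - 1` and pick them up. -/
def picks (k m : ℕ) : List Leg :=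
  (List.range' k (m - k)).map (fun i => ⟨I.pos i, Task.pick⟩)

/-- Deposit sensors at the slots `k, …, m - 1`, from left to right. -/
def drops (k m : ℕ) : List Leg :=
  (List.range' k (m - k)).map (fun i => ⟨I.slot i, Task.drop⟩)

/-- Walk right in surplus, picking up the sensors `k, …, m - 1` where they are met and depositing
them at their slots. -/
def surplusLegs (k m : ℕ) : List Leg :=
  List.merge (I.picks k m) (I.drops k m) (fun a b => decide (a.dest ≤ b.dest))

/-- The value `x` and the moves of `walk-in-surplus`, the sensors before `k` having been dealt
with. The result is `none` if the robot reaches the end of the barrier; it then stops at `L - r`.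
Otherwise it is the index `m` of the next missing sensor, and the robot stops at its attached
position `x`, a potential right-turning point, with a gap starting at `x - r`. -/
def walkInSurplus (k : ℕ) : List Leg × Option ℕ :=
  match I.firstDeficit k with
  | none => (I.surplusLegs k I.needed, none)
  | some m => (I.surplusLegs k m ++ [⟨I.spot m, Task.pass⟩], some m)

theorem walkInSurplus_le {k m : ℕ} (h : (I.walkInSurplus k).2 = some m) :
    k ≤ m ∧ m < I.sensors.length := by
  unfold walkInSurplus at h
  split at h
  · simp at h
  · rename_i m' hm
    simp only [Option.some.injEq] at h
    subst h
    have := List.mem_of_find?_eq_some hm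
    rw [List.mem_range'_1] at this
    omega

theorem firstLeftTurn_le {k j : ℕ} (h : I.firstLeftTurn k = some j) :
    k ≤ j ∧ j < I.sensors.length := by
  have := List.mem_of_find?_eq_some h
  rw [List.mem_range'_1] at this
  omega

/-- The main loop of AdaptiveOnline on the subinterval `[t, L]`, at the start of an iteration: the
sensors before `k` are deposited in attached positions, the robot stands at the potential
right-turning point `b`, the attached position of sensor `k`, and `T` is the length of the part of
its trajectory from `t` to `b - r`. Distances within the subinterval are measured from `t`. -/
def loop (t T : ℝ) (k : ℕ) : List Leg :=
  match hj : I.firstLeftTurn k with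
  | none => []
  | some j =>
    let b := I.spot k
    let a := I.pos j
    let T₁ := T + I.r + 3 * (a - b)
    if T₁ - (a - t) > I.L - t then
      -- walk on to `L - r`, collecting all sensors, and back to `b`, depositing them
      I.picks k I.sensors.length ++ (I.drops k I.needed).reverse
    else
      -- the triple on `[b, a]`, then walk in surplus
      I.picks k (j + 1) ++ (I.drops k (j + 1)).reverse ++ [⟨a, Task.pass⟩] ++
      (I.walkInSurplus (j + 1)).1 ++
      match hm : (I.walkInSurplus (j + 1)).2 with
      | none => []
      | some m =>
        let x := I.spot m
        let T₂ := T₁ + (x - I.r - a)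
        if T₂ / (x - I.r - t) ≤ 5 / 2 then
          -- the recursive call on `[x - r, L]`
          loop (x - I.r) 0 m
        else
          loop t T₂ m
termination_by I.sensors.length - k
decreasing_by
  all_goals
    have h1 := I.firstLeftTurn_le hj
    have h2 := I.walkInSurplus_le hm
    omega

end Inst

/-- AdaptiveOnline: walk in surplus from `0` to the first gap (which may be at `0`) and run the
main loop on the remaining subinterval. -/
def adaptiveOnline (I : Inst) : List Leg :=
  (I.walkInSurplus 0).1 ++
  match (I.walkInSurplus 0).2 with
  | none => []
  | some k => I.loop (I.spot k - I.r) 0 k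

end BarrierCoverage

end

open BarrierCoverage

namespace BarrierCoverage

open MeasureTheory Set


/-! ### Trajectories -/

/-- The position of a robot that starts at `q` after the given legs. -/
def finalPos : ℝ → List Leg → ℝ
  | q, [] => q
  | _, l :: ls => finalPos l.dest ls

theorem finalPos_append (q : ℝ) (u v : List Leg) :
    finalPos q (u ++ v) = finalPos (finalPos q u) v := by
  induction u generalizing q with
  | nil => rfl
  | cons l ls ih => exact ih l.dest

theorem lengthFrom_append (q : ℝ) (u v : List Leg) :
    lengthFrom q (u ++ v) = lengthFrom q u + lengthFrom (finalPos q u) v := by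
  induction u generalizing q with
  | nil => simp [lengthFrom, finalPos]
  | cons l ls ih => simp [lengthFrom, finalPos, ih l.dest, add_assoc]

theorem abs_finalPos_sub_le (q : ℝ) (u : List Leg) : |finalPos q u - q| ≤ lengthFrom q u := by
  induction u generalizing q with
  | nil => simp [lengthFrom, finalPos]
  | cons l ls ih =>
    simp only [lengthFrom, finalPos]
    have := abs_sub_le (finalPos l.dest ls) l.dest q
    linarith [ih l.dest]

theorem lengthFrom_nonneg (q : ℝ) (u : List Leg) : 0 ≤ lengthFrom q u :=
  (abs_nonneg _).trans (abs_finalPos_sub_le q u)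

theorem lengthFrom_le_abs_add (q q' : ℝ) (u : List Leg) :
    lengthFrom q u ≤ |q' - q| + lengthFrom q' u := by
  cases u with
  | nil => simp [lengthFrom]
  | cons l ls =>
    simp only [lengthFrom]
    have := abs_sub_le l.dest q' q
    linarith

theorem le_lengthFrom_of_mem {q : ℝ} {u : List Leg} {l : Leg} (h : l ∈ u) :
    |l.dest - q| + |finalPos q u - l.dest| ≤ lengthFrom q u := by
  obtain ⟨v, w, rfl⟩ := List.append_of_mem h
  rw [lengthFrom_append, finalPos_append]
  simp only [lengthFrom, finalPos]
  have h1 := abs_sub_le l.dest (finalPos q v) q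
  linarith [abs_finalPos_sub_le q v, abs_finalPos_sub_le l.dest w]

theorem finalPos_mem_dest (q : ℝ) {u : List Leg} (h : u ≠ []) :
    ∃ l ∈ u, finalPos q u = l.dest := by
  induction u generalizing q with
  | nil => exact absurd rfl h
  | cons l ls ih =>
    by_cases h' : ls = []
    · subst h'
      exact ⟨l, by simp, rfl⟩
    · obtain ⟨x, hx, h2⟩ := ih l.dest h'
      exact ⟨x, List.mem_cons_of_mem _ hx, h2⟩

/-! ### Executions -/

theorem Run.append {L : ℝ} {s s' s'' : State} {u v : List Leg} (h : Run L s u s')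
    (h' : Run L s' v s'') : Run L s (u ++ v) s'' := by
  induction h with
  | nil => exact h'
  | cons _ _ _ _ _ h1 _ ih => exact .cons _ _ _ _ _ h1 (ih h')

theorem Run.dest_mem {L : ℝ} {s s' : State} {u : List Leg} (h : Run L s u s') :
    ∀ l ∈ u, 0 ≤ l.dest ∧ l.dest ≤ L := by
  induction h with
  | nil => simp
  | cons _ _ _ _ _ h1 _ ih =>
    intro l hl
    rcases List.mem_cons.1 hl with rfl | hl
    · cases h1 <;> exact ⟨by assumption, by assumption⟩
    · exact ih l hl

theorem Run.mem_ground {L : ℝ} {s s' : State} {u : List Leg} (h : Run L s u s') {x : ℝ}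
    (hx : x ∈ s'.ground) : x ∈ s.ground ∨ ∃ l ∈ u, l.dest = x := by
  induction h with
  | nil => exact .inl hx
  | cons _ _ _ _ _ h1 _ ih =>
    rcases ih hx with h2 | ⟨l, hl, h2⟩
    · cases h1 with
      | pass => exact .inl h2
      | pick => exact .inl (Multiset.mem_cons_of_mem h2)
      | drop p =>
        rcases Multiset.mem_cons.1 h2 with h3 | h3
        · exact .inr ⟨_, List.mem_cons_self, h3.symm⟩
        · exact .inl h3
    · exact .inr ⟨l, List.mem_cons_of_mem _ hl, h2⟩

theorem Run.countP_ground_eq {L z : ℝ} {s s' : State} {u : List Leg} (h : Run L s u s')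
    (hu : ∀ l ∈ u, z ≤ l.dest) :
    s'.ground.countP (· < z) = s.ground.countP (· < z) := by
  induction h with
  | nil => rfl
  | cons _ _ _ l _ h1 _ ih =>
    rw [ih fun l hl => hu l (List.mem_cons_of_mem _ hl)]
    have h2 := hu l List.mem_cons_self
    cases h1 with
    | pass => rfl
    | pick => simp [h2]
    | drop => simp [h2]

/-- The robot visits `[w, ∞)` and later `(-∞, z)`. -/
def Returns (w z : ℝ) (u : List Leg) : Prop :=
  ∃ u₁ x u₂ y u₃, u = u₁ ++ x :: u₂ ++ y :: u₃ ∧ w ≤ x.dest ∧ y.dest < z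

/-- A robot that never returns from `[w, ∞)` to `(-∞, z)` leaves in `(-∞, z)` at most the sensors
that were carried or lay in `(-∞, w)` in the beginning. -/
theorem Run.countP_ground_le {L w z : ℝ} (hzw : z ≤ w) {s s' : State} {u : List Leg}
    (h : Run L s u s') (hu : ¬ Returns w z u) :
    s'.ground.countP (· < z) ≤ s.ground.countP (· < w) + s.carried := by
  have mono : ∀ g : Multiset ℝ, g.countP (· < z) ≤ g.countP (· < w) := by
    intro g
    rw [Multiset.countP_eq_card_filter, Multiset.countP_eq_card_filter]
    exact Multiset.card_le_card
      (Multiset.monotone_filter_right g fun x (hx : x < z) => hx.trans_le hzw)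
  induction h with
  | nil => exact (mono _).trans (Nat.le_add_right _ _)
  | cons s s₁ s₂ l ls h1 h2 ih =>
    by_cases hl : l.dest < w
    · have h3 : ¬ Returns w z ls := by
        rintro ⟨u₁, x, u₂, y, u₃, rfl, hx, hy⟩
        exact hu ⟨l :: u₁, x, u₂, y, u₃, by simp, hx, hy⟩
      refine (ih h3).trans (le_of_eq ?_)
      cases h1 with
      | pass => rfl
      | pick p c g =>
        have hl' : p < w := hl
        simp only [Multiset.countP_cons, hl', if_true]
        omega
      | drop p c g =>
        have hl' : p < w := hl
        simp only [Multiset.countP_cons, hl', if_true]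
        omega
    · have h3 : ∀ x ∈ l :: ls, z ≤ x.dest := by
        intro x hx
        rcases List.mem_cons.1 hx with rfl | hx
        · linarith
        · by_contra hxz
          obtain ⟨v, t, rfl⟩ := List.append_of_mem hx
          exact hu ⟨[], l, v, x, t, by simp, by linarith, by linarith⟩
      rw [Run.countP_ground_eq (.cons _ _ _ _ _ h1 h2) h3]
      exact (mono _).trans (Nat.le_add_right _ _)

/-! ### Coverage -/

theorem Covers.le_countP {L r z : ℝ} (hr : 0 < r) {g : Multiset ℝ} (h : Covers L r g)
    (hz : z - r ≤ L) : z - r ≤ 2 * r * g.countP (· < z) := by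
  have h1 : Ico 0 (z - r) ⊆ ⋃ s ∈ (g.filter (· < z)).toFinset, Icc (s - r) (s + r) := by
    intro y hy
    obtain ⟨s, hs, h1, h2⟩ := h y hy.1 (hy.2.le.trans hz)
    simp only [Multiset.mem_toFinset, Multiset.mem_filter, mem_iUnion, exists_prop]
    exact ⟨s, ⟨hs, by linarith [hy.2]⟩, h1, h2⟩
  have h2 : ENNReal.ofReal (z - r) ≤ ENNReal.ofReal (2 * r * g.countP (· < z)) := by
    calc ENNReal.ofReal (z - r) = volume (Ico 0 (z - r)) := by simp
      _ ≤ _ := measure_mono h1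
      _ ≤ _ := measure_biUnion_finset_le _ _
      _ = (g.filter (· < z)).toFinset.card * ENNReal.ofReal (2 * r) := by
        simp [Real.volume_Icc, two_mul]
      _ ≤ (g.filter (· < z)).card * ENNReal.ofReal (2 * r) := by
        gcongr
        exact Multiset.toFinset_card_le _
      _ = _ := by
        rw [Multiset.countP_eq_card_filter, mul_comm (2 * r),
          ENNReal.ofReal_mul (Nat.cast_nonneg _), ENNReal.ofReal_natCast]
  rwa [ENNReal.ofReal_le_ofReal_iff (by positivity)] at h2

/-- The number of sensors initially in `(-∞, z)`. -/
noncomputable def Inst.numLeft (I : Inst) (z : ℝ) : ℕ := (I.sensors : Multiset ℝ).countP (· < z)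

theorem RestoresCoverage.exists_dest_ge {I : Inst} {u : List Leg} (h : RestoresCoverage I u) :
    ∃ l ∈ u, I.L - I.r ≤ l.dest := by
  obtain ⟨s, h1, h2⟩ := h
  obtain ⟨x, hx, -, h3⟩ := h2 I.L I.L_pos.le le_rfl
  rcases h1.mem_ground hx with h4 | ⟨l, hl, rfl⟩
  · exact absurd (I.end_uncovered x (by simpa using h4)) (by linarith)
  · exact ⟨l, hl, by linarith⟩

theorem RestoresCoverage.returns {I : Inst} {u : List Leg} (h : RestoresCoverage I u) {w z : ℝ}
    (hzw : z ≤ w) (hz : z - I.r ≤ I.L) (hw : 2 * I.r * I.numLeft w + I.r < z) :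
    Returns w z u := by
  by_contra hu
  obtain ⟨s, h1, h2⟩ := h
  have h3 := h2.le_countP I.r_pos hz
  have h4 : (s.ground.countP (· < z) : ℝ) ≤ I.numLeft w := by
    exact_mod_cast h1.countP_ground_le hzw hu
  have := I.r_pos
  nlinarith

/-! ### Crossings -/

/-- The number of legs that cross `z` from left to right. -/
noncomputable def crossR (z : ℝ) : ℝ → List Leg → ℕ
  | _, [] => 0
  | q, l :: ls => (if q < z ∧ z ≤ l.dest then 1 else 0) + crossR z l.dest ls

/-- The number of legs that cross `z` from right to left. -/
noncomputable def crossL (z : ℝ) : ℝ → List Leg → ℕ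
  | _, [] => 0
  | q, l :: ls => (if l.dest < z ∧ z ≤ q then 1 else 0) + crossL z l.dest ls

theorem crossL_append (z q : ℝ) (u v : List Leg) :
    crossL z q (u ++ v) = crossL z q u + crossL z (finalPos q u) v := by
  induction u generalizing q with
  | nil => simp [crossL, finalPos]
  | cons l ls ih => simp [crossL, finalPos, ih l.dest, add_assoc]

theorem crossR_balance (z q : ℝ) (u : List Leg) :
    (crossR z q u : ℤ) - crossL z q u =
      (if z ≤ finalPos q u then 1 else 0) - (if z ≤ q then 1 else 0) := by
  induction u generalizing q with
  | nil => by_cases h : z ≤ q <;> simp [crossL, crossR, finalPos, h]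
  | cons l ls ih =>
    have := ih l.dest
    simp only [crossL, crossR, finalPos]
    push_cast
    split_ifs at this ⊢ <;> grind

theorem one_le_crossL {z q : ℝ} {u : List Leg} (h : Returns z z u) : 1 ≤ crossL z q u := by
  obtain ⟨u₁, x, u₂, y, u₃, rfl, hx, hy⟩ := h
  rw [List.append_assoc, crossL_append, List.cons_append, crossL,
    show u₂ ++ y :: u₃ = (u₂ ++ [y]) ++ u₃ by simp, crossL_append]
  have := crossR_balance z x.dest (u₂ ++ [y])
  rw [finalPos_append, if_pos hx, if_neg (by simpa [finalPos] using hy)] at this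
  omega

theorem one_le_crossR {z q : ℝ} (hq : q < z) {u : List Leg} {l : Leg} (hl : l ∈ u)
    (h : z ≤ l.dest) : 1 ≤ crossR z q u := by
  induction u generalizing q with
  | nil => simp at hl
  | cons x ls ih =>
    rw [crossR]
    by_cases hx : z ≤ x.dest
    · rw [if_pos ⟨hq, hx⟩]; omega
    · rcases List.mem_cons.1 hl with rfl | hl
      · exact absurd h hx
      · have := ih (not_le.1 hx) hl
        omega

theorem measurable_crossings (q : ℝ) (u : List Leg) :
    Measurable fun z => ((crossR z q u + crossL z q u : ℕ) : ENNReal) := by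
  induction u generalizing q with
  | nil => simp [crossR, crossL]
  | cons l ls ih =>
    have h1 : Measurable fun z : ℝ => (if q < z ∧ z ≤ l.dest then (1 : ENNReal) else 0) :=
      Measurable.ite (measurableSet_Ioc (a := q) (b := l.dest)) measurable_const measurable_const
    have h2 : Measurable fun z : ℝ => (if l.dest < z ∧ z ≤ q then (1 : ENNReal) else 0) :=
      Measurable.ite (measurableSet_Ioc (a := l.dest) (b := q)) measurable_const measurable_const
    convert (h1.add h2).add (ih l.dest) using 2 with z
    simp only [crossR, crossL]
    push_cast
    simp only [Pi.add_apply]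
    ring

theorem lintegral_crossings (q : ℝ) (u : List Leg) :
    ∫⁻ z, ((crossR z q u + crossL z q u : ℕ) : ENNReal) = ENNReal.ofReal (lengthFrom q u) := by
  induction u generalizing q with
  | nil => simp [crossR, crossL, lengthFrom]
  | cons l ls ih =>
    have h1 : ∀ z, ((crossR z q (l :: ls) + crossL z q (l :: ls) : ℕ) : ENNReal) =
        ((Ioc q l.dest).indicator 1 z + (Ioc l.dest q).indicator 1 z) +
          ((crossR z l.dest ls + crossL z l.dest ls : ℕ) : ENNReal) := by
      intro z
      simp only [crossR, crossL, indicator, mem_Ioc, Pi.one_apply]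
      push_cast
      ring
    simp_rw [h1]
    rw [lintegral_add_right _ (measurable_crossings _ _),
      lintegral_add_right _ (measurable_one.indicator measurableSet_Ioc),
      lintegral_indicator_one measurableSet_Ioc, lintegral_indicator_one measurableSet_Ioc,
      ih, Real.volume_Ioc, Real.volume_Ioc, lengthFrom,
      ENNReal.ofReal_add (abs_nonneg _) (lengthFrom_nonneg _ _)]
    congr 1
    rcases le_total q l.dest with h | h
    · rw [ENNReal.ofReal_eq_zero.2 (by linarith : q - l.dest ≤ 0), abs_of_nonneg (by linarith),
        add_zero]
    · rw [ENNReal.ofReal_eq_zero.2 (by linarith : l.dest - q ≤ 0), abs_of_nonpos (by linarith),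
        zero_add, neg_sub]

/-! ### Deficit and the offline lower bound -/

namespace Inst

variable (I : Inst)

/-- The points `z` for which the sensors in `(-∞, z)` do not suffice to cover `[0, z - r)`. -/
def deficitSet : Set ℝ := {z | I.spot (I.numLeft z) < z}

/-- The measure of the deficit set within `[0, e]`. -/
noncomputable def deficit (e : ℝ) : ℝ := volume.real (I.deficitSet ∩ Ioc 0 e)

theorem numLeft_mono : Monotone I.numLeft := by
  intro a b hab
  unfold numLeft
  rw [Multiset.countP_eq_card_filter, Multiset.countP_eq_card_filter]
  exact Multiset.card_le_card
    (Multiset.monotone_filter_right _ fun x (hx : x < a) => hx.trans_le hab)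

theorem measurableSet_deficitSet : MeasurableSet I.deficitSet := by
  have h : Measurable I.numLeft := I.numLeft_mono.measurable
  have h2 : Measurable fun z => I.spot (I.numLeft z) := by
    unfold spot
    exact (((measurable_from_nat (f := fun n : ℕ => (n : ℝ))).comp h).const_mul _).add_const _
  exact measurableSet_lt h2 measurable_id

theorem deficit_zero : I.deficit 0 = 0 := by simp [deficit]

theorem deficit_sub {x y : ℝ} (hx : 0 ≤ x) (hxy : x ≤ y) :
    I.deficit y - I.deficit x = volume.real (I.deficitSet ∩ Ioc x y) := by
  have h1 : I.deficitSet ∩ Ioc 0 y = I.deficitSet ∩ Ioc 0 x ∪ I.deficitSet ∩ Ioc x y := by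
    rw [← inter_union_distrib_left, Ioc_union_Ioc_eq_Ioc hx hxy]
  have hfin : ∀ a b : ℝ, volume (I.deficitSet ∩ Ioc a b) ≠ ⊤ := fun a b =>
    measure_ne_top_of_subset inter_subset_right (by simp)
  rw [deficit, deficit, h1, measureReal_union _
    (I.measurableSet_deficitSet.inter measurableSet_Ioc) (hfin _ _) (hfin _ _)]
  · ring
  · exact (Ioc_disjoint_Ioc_of_le le_rfl).mono inter_subset_right inter_subset_right

theorem deficit_mono {x y : ℝ} (hx : 0 ≤ x) (hxy : x ≤ y) : I.deficit x ≤ I.deficit y := by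
  have := I.deficit_sub hx hxy
  linarith [measureReal_nonneg (μ := volume) (s := I.deficitSet ∩ Ioc x y)]

theorem deficit_sub_le {x y : ℝ} (hx : 0 ≤ x) (hxy : x ≤ y) :
    I.deficit y - I.deficit x ≤ y - x := by
  rw [I.deficit_sub hx hxy]
  refine (measureReal_mono inter_subset_right (by simp)).trans (le_of_eq ?_)
  rw [Real.volume_real_Ioc_of_le hxy]

theorem deficit_nonneg (x : ℝ) : 0 ≤ I.deficit x := measureReal_nonneg

theorem deficit_sub_eq_of_subset {x y : ℝ} (hx : 0 ≤ x) (hxy : x ≤ y)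
    (h : Ioc x y ⊆ I.deficitSet) : I.deficit y - I.deficit x = y - x := by
  rw [I.deficit_sub hx hxy, inter_eq_right.2 h, Real.volume_real_Ioc_of_le hxy]

theorem deficit_eq_of_disjoint {x y : ℝ} (hx : 0 ≤ x) (hxy : x ≤ y)
    (h : ∀ z ∈ Ioc x y, z ∉ I.deficitSet) : I.deficit y = I.deficit x := by
  have h1 : I.deficitSet ∩ Ioc x y = ∅ := by
    ext z
    simp only [mem_inter_iff, mem_empty_iff_false, iff_false, not_and]
    exact fun h1 h2 => h z h2 h1
  have h2 := I.deficit_sub hx hxy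
  rw [h1, measureReal_empty] at h2
  linarith

theorem sensors_ne_nil : I.sensors ≠ [] := by
  intro h
  have := I.enough
  rw [h] at this
  simp at this
  linarith [I.L_pos]

theorem r_lt_L : I.r < I.L := by
  obtain ⟨x, hx⟩ := List.exists_mem_of_ne_nil _ I.sensors_ne_nil
  linarith [I.nonneg x hx, I.end_uncovered x hx]

end Inst

/-- A trajectory that ends at `e` crosses every point of `[e, L - r]` at least twice, and of the
other points those in deficit at least three times. -/
theorem RestoresCoverage.le_trajLength {I : Inst} {u : List Leg} (h : RestoresCoverage I u) :
    ∃ e, e ≤ I.L - I.r ∧ 2 * (I.L - I.r) - e + 2 * I.deficit e ≤ trajLength u := by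
  have hrL := I.r_lt_L
  have hr := I.r_pos
  obtain ⟨l, hl, hlM⟩ := h.exists_dest_ge
  have hf0 : 0 ≤ finalPos 0 u := by
    obtain ⟨s, h1, -⟩ := h
    obtain ⟨x, hx, h2⟩ := finalPos_mem_dest 0 (List.ne_nil_of_mem hl)
    rw [h2]
    exact (h1.dest_mem x hx).1
  set M := I.L - I.r with hM
  set e := min (finalPos 0 u) M with he
  have he0 : 0 ≤ e := le_min hf0 (by linarith)
  have heM : e ≤ M := min_le_right _ _
  refine ⟨e, heM, ?_⟩
  have key : ∀ z, (Ioc 0 M).indicator (1 : ℝ → ENNReal) z + (Ioc e M).indicator 1 z +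
      ((I.deficitSet ∩ Ioc 0 e).indicator 1 z + (I.deficitSet ∩ Ioc 0 e).indicator 1 z) ≤
      ((crossR z 0 u + crossL z 0 u : ℕ) : ENNReal) := by
    intro z
    by_cases hz : z ∈ Ioc 0 M
    · have hb := crossR_balance z 0 u
      rw [if_neg (not_le.2 hz.1)] at hb
      have hR := one_le_crossR hz.1 hl (hz.2.trans hlM)
      by_cases hze : e < z
      · rw [indicator_of_mem hz, indicator_of_mem (show z ∈ Ioc e M from ⟨hze, hz.2⟩),
          indicator_of_notMem (fun h => absurd h.2.2 (not_le.2 hze))]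
        have hfz : finalPos 0 u < z := by
          rcases min_lt_iff.1 hze with h1 | h1
          · exact h1
          · exact absurd hz.2 (not_le.2 h1)
        rw [if_neg (not_le.2 hfz)] at hb
        have : 2 ≤ crossR z 0 u + crossL z 0 u := by omega
        simp only [Pi.one_apply, add_zero, one_add_one_eq_two]
        exact_mod_cast this
      · rw [indicator_of_mem hz, indicator_of_notMem (fun h : z ∈ Ioc e M => hze h.1)]
        by_cases hzd : z ∈ I.deficitSet
        · rw [indicator_of_mem (show z ∈ I.deficitSet ∩ Ioc 0 e from
            ⟨hzd, hz.1, not_lt.1 hze⟩)]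
          have hL := one_le_crossL (q := 0)
            (h.returns le_rfl (by linarith [hz.2]) (show _ < z from hzd))
          rw [if_pos ((not_lt.1 hze).trans (min_le_left _ _))] at hb
          have : 1 + (1 + 1) ≤ crossR z 0 u + crossL z 0 u := by omega
          simp only [Pi.one_apply, add_zero]
          exact_mod_cast this
        · rw [indicator_of_notMem (fun h => hzd h.1)]
          simp only [Pi.one_apply, add_zero]
          exact_mod_cast hR.trans (Nat.le_add_right _ _)
    · have h1 : z ∉ Ioc e M := fun h => hz ⟨he0.trans_lt h.1, h.2⟩
      have h2 : z ∉ I.deficitSet ∩ Ioc 0 e := fun h => hz ⟨h.2.1, h.2.2.trans heM⟩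
      simp [indicator_of_notMem hz, indicator_of_notMem h1, indicator_of_notMem h2]
  have hD := I.measurableSet_deficitSet.inter (measurableSet_Ioc (a := (0 : ℝ)) (b := e))
  have h3 := lintegral_mono (μ := volume) key
  have hD1 : Measurable ((I.deficitSet ∩ Ioc 0 e).indicator (1 : ℝ → ENNReal)) :=
    measurable_one.indicator hD
  have hD2 : Measurable fun z => (I.deficitSet ∩ Ioc 0 e).indicator (1 : ℝ → ENNReal) z +
      (I.deficitSet ∩ Ioc 0 e).indicator 1 z := hD1.add hD1
  have hvol : volume (I.deficitSet ∩ Ioc 0 e) = ENNReal.ofReal (I.deficit e) := by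
    rw [Inst.deficit, ofReal_measureReal
      (measure_ne_top_of_subset inter_subset_right (by simp))]
  rw [lintegral_crossings,
    lintegral_add_right _ hD2,
    lintegral_add_right _ (measurable_one.indicator measurableSet_Ioc),
    lintegral_add_right _ hD1, lintegral_indicator_one hD,
    lintegral_indicator_one measurableSet_Ioc, lintegral_indicator_one measurableSet_Ioc, hvol,
    Real.volume_Ioc, Real.volume_Ioc,
    ← ENNReal.ofReal_add (by linarith) (by linarith),
    ← ENNReal.ofReal_add (I.deficit_nonneg e) (I.deficit_nonneg e),
    ← ENNReal.ofReal_add (by linarith) (by linarith [I.deficit_nonneg e]),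
    ENNReal.ofReal_le_ofReal_iff (lengthFrom_nonneg _ _)] at h3
  unfold trajLength
  linarith


namespace Inst

variable (I : Inst)

/-! ### Positions, slots and balances -/

theorem pos_eq_getElem {i : ℕ} (hi : i < I.sensors.length) : I.pos i = I.sensors[i] :=
  List.getD_eq_getElem _ _ hi

theorem pos_mem {i : ℕ} (hi : i < I.sensors.length) : I.pos i ∈ I.sensors := by
  rw [I.pos_eq_getElem hi]
  exact List.getElem_mem hi

theorem pos_nonneg {i : ℕ} (hi : i < I.sensors.length) : 0 ≤ I.pos i := I.nonneg _ (I.pos_mem hi)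

theorem pos_lt {i : ℕ} (hi : i < I.sensors.length) : I.pos i < I.L - I.r := by
  linarith [I.end_uncovered _ (I.pos_mem hi)]

theorem pos_mono {i j : ℕ} (hij : i ≤ j) (hj : j < I.sensors.length) : I.pos i ≤ I.pos j := by
  rw [I.pos_eq_getElem hj, I.pos_eq_getElem (hij.trans_lt hj)]
  exact I.sorted.sortedLE.monotone_get (a := ⟨i, _⟩) (b := ⟨j, hj⟩) hij

theorem spot_succ (i : ℕ) : I.spot (i + 1) = I.spot i + 2 * I.r := by
  unfold spot
  push_cast
  ring

theorem spot_mono : Monotone I.spot := by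
  intro i j hij
  have : (i : ℝ) ≤ j := by exact_mod_cast hij
  have := I.r_pos
  unfold spot
  nlinarith

theorem r_le_spot (i : ℕ) : I.r ≤ I.spot i := by
  have := I.spot_mono (Nat.zero_le i)
  simpa [spot] using this

theorem slot_eq_spot {i : ℕ} (h : I.spot i ≤ I.L - I.r) : I.slot i = I.spot i := min_eq_left h

theorem slot_le (i : ℕ) : I.slot i ≤ I.L - I.r := min_le_right _ _

theorem slot_mono : Monotone I.slot := fun _ _ h => min_le_min_right _ (I.spot_mono h)

theorem slot_nonneg (i : ℕ) : 0 ≤ I.slot i :=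
  le_min (I.r_pos.le.trans (I.r_le_spot i)) (by linarith [I.r_lt_L])

theorem needed_le_length : I.needed ≤ I.sensors.length := by
  refine Nat.ceil_le.2 ?_
  rw [div_le_iff₀ (by linarith [I.r_pos])]
  linarith [I.enough]

theorem L_le_needed : I.L ≤ 2 * I.r * I.needed := by
  have := Nat.le_ceil (I.L / (2 * I.r))
  rw [div_le_iff₀ (by linarith [I.r_pos])] at this
  unfold needed
  linarith

theorem lt_needed_iff {i : ℕ} : i < I.needed ↔ 2 * I.r * i < I.L := by
  rw [needed, Nat.lt_ceil, lt_div_iff₀ (by linarith [I.r_pos]), mul_comm]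

theorem needed_pos : 0 < I.needed := I.lt_needed_iff.2 (by simpa using I.L_pos)

theorem lt_needed_of_spot_lt {i : ℕ} (h : I.spot i < I.L - I.r) : i + 1 < I.needed := by
  rw [lt_needed_iff]
  unfold spot at h
  push_cast
  linarith

theorem slot_needed_sub_one : I.slot (I.needed - 1) = I.L - I.r := by
  refine min_eq_right ?_
  have h1 := I.L_le_needed
  have h2 : ((I.needed - 1 : ℕ) : ℝ) = I.needed - 1 := by
    rw [Nat.cast_sub I.needed_pos, Nat.cast_one]
  rw [spot, h2]
  linarith

theorem spot_lt_of_balance_neg {i : ℕ} (hi : i < I.sensors.length) (h : I.balance i < 0) :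
    I.spot i < I.pos i ∧ I.spot i < I.L - I.r ∧ i + 1 < I.needed := by
  have h1 : I.spot i < I.pos i := by
    unfold balance at h
    linarith
  have h2 := h1.trans (I.pos_lt hi)
  exact ⟨h1, h2, I.lt_needed_of_spot_lt h2⟩

theorem pos_le_spot {i : ℕ} (h : 0 ≤ I.balance i) : I.pos i ≤ I.spot i := by
  unfold balance at h
  linarith

theorem pos_le_slot {i : ℕ} (hi : i < I.sensors.length) (h : 0 ≤ I.balance i) :
    I.pos i ≤ I.slot i := le_min (I.pos_le_spot h) (I.pos_lt hi).le

/-! ### The searches -/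

theorem firstDeficit_some {k m : ℕ} (h : I.firstDeficit k = some m) :
    k ≤ m ∧ m < I.sensors.length ∧ I.balance m < 0 ∧ ∀ i, k ≤ i → i < m → 0 ≤ I.balance i := by
  rw [firstDeficit, List.find?_range'_eq_some] at h
  obtain ⟨h1, h2, h3⟩ := h
  rw [List.mem_range'_1] at h2
  exact ⟨h2.1, by omega, by simpa using h1, fun i hi him => by simpa using h3 i hi him⟩

theorem firstDeficit_none {k : ℕ} (h : I.firstDeficit k = none) {i : ℕ} (hi : k ≤ i)
    (hn : i < I.sensors.length) : 0 ≤ I.balance i := by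
  rw [firstDeficit, List.find?_range'_eq_none] at h
  simpa using h i hi (by omega)

theorem firstDeficit_eq_some {k m : ℕ} (hk : k ≤ m) (hm : m < I.sensors.length)
    (h1 : I.balance m < 0) (h2 : ∀ i, k ≤ i → i < m → 0 ≤ I.balance i) :
    I.firstDeficit k = some m := by
  rw [firstDeficit, List.find?_range'_eq_some]
  refine ⟨by simpa using h1, ?_, fun i hi him => by simpa using h2 i hi him⟩
  rw [List.mem_range'_1]
  omega

theorem firstLeftTurn_eq_some {k j : ℕ} :
    I.firstLeftTurn k = some j ↔ (k ≤ j ∧ j < I.sensors.length) ∧ I.LeftTurn j ∧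
      ∀ i, k ≤ i → i < j → ¬ I.LeftTurn i := by
  rw [firstLeftTurn, List.find?_range'_eq_some, List.mem_range'_1]
  simp only [decide_eq_true_eq, Bool.not_eq_true', decide_eq_false_iff_not]
  constructor
  · rintro ⟨h1, h2, h3⟩
    exact ⟨⟨h2.1, by omega⟩, h1, h3⟩
  · rintro ⟨h2, h1, h3⟩
    exact ⟨h1, by omega, h3⟩

/-- Before the first left-turning point the deficit is not made up. -/
theorem deficit_of_not_leftTurn {k j : ℕ} (hjn : j < I.sensors.length) (hk : I.balance k < 0)
    (h : ∀ i, k ≤ i → i < j → ¬ I.LeftTurn i) {i : ℕ} (hki : k ≤ i) (hij : i ≤ j) :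
    I.balance i < 0 ∧ (i < j → I.spot (i + 1) ≤ I.pos i ∧ I.spot (i + 1) < I.pos (i + 1)) := by
  induction i, hki using Nat.le_induction with
  | base =>
    refine ⟨hk, fun hkj => ?_⟩
    have h1 := h k le_rfl hkj
    have h2 := I.pos_mono (Nat.le_succ k) (by omega)
    rw [LeftTurn, not_or] at h1
    have h3 : I.balance k ≤ -(2 * I.r) := by
      by_contra h4
      exact h1.1 ⟨not_le.1 h4, hk⟩
    have h5 : I.balance k = -(2 * I.r) → I.pos (k + 1) ≠ I.pos k := fun h6 h7 =>
      h1.2 ⟨h6, by omega, h7⟩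
    rw [I.spot_succ]
    simp only [balance] at h3 h5
    refine ⟨by linarith, ?_⟩
    by_contra h6
    exact h5 (by linarith) (by linarith)
  | succ i hki ih =>
    have h0 := (ih (by omega)).2 (by omega)
    have hb : I.balance (i + 1) < 0 := by
      unfold balance
      linarith
    refine ⟨hb, fun hkj => ?_⟩
    have h1 := h (i + 1) (by omega) hkj
    have h2 := I.pos_mono (Nat.le_succ (i + 1)) (by omega)
    rw [LeftTurn, not_or] at h1
    have h3 : I.balance (i + 1) ≤ -(2 * I.r) := by
      by_contra h4
      exact h1.1 ⟨not_le.1 h4, hb⟩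
    have h5 : I.balance (i + 1) = -(2 * I.r) → I.pos (i + 1 + 1) ≠ I.pos (i + 1) := fun h6 h7 =>
      h1.2 ⟨h6, by omega, h7⟩
    rw [I.spot_succ]
    simp only [balance] at h3 h5
    refine ⟨by linarith, ?_⟩
    by_contra h6
    exact h5 (by linarith) (by linarith)

theorem exists_firstLeftTurn {k : ℕ} (hk : k < I.sensors.length) (h : I.balance k < 0) :
    ∃ j, I.firstLeftTurn k = some j := by
  cases hj : I.firstLeftTurn k with
  | some j => exact ⟨j, rfl⟩
  | none =>
    exfalso
    rw [firstLeftTurn, List.find?_range'_eq_none] at hj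
    simp only [Bool.not_eq_true', decide_eq_false_iff_not] at hj
    have h1 := (I.deficit_of_not_leftTurn (j := I.sensors.length - 1) (by omega) h
      (fun i hi hij => hj i hi (by omega)) (i := I.sensors.length - 1) (by omega) le_rfl).1
    have h2 := (I.spot_lt_of_balance_neg (by omega) h1).2.2
    have := I.needed_le_length
    omega

theorem firstLeftTurn_spec {k j : ℕ} (h : I.firstLeftTurn k = some j) (hk : I.balance k < 0) :
    (k ≤ j ∧ j < I.sensors.length) ∧ I.balance j < 0 ∧ j + 1 < I.needed ∧
      I.spot k < I.pos j := by
  obtain ⟨h1, h2, h3⟩ := I.firstLeftTurn_eq_some.1 h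
  have h4 := (I.deficit_of_not_leftTurn h1.2 hk h3 h1.1 le_rfl).1
  have h5 := I.spot_lt_of_balance_neg h1.2 h4
  exact ⟨h1, h4, h5.2.2, (I.spot_mono h1.1).trans_lt h5.1⟩

/-! ### Lists of legs -/

theorem picks_of_le {k m : ℕ} (h : m ≤ k) : I.picks k m = [] := by
  simp [picks, Nat.sub_eq_zero_of_le h]

theorem drops_of_le {k m : ℕ} (h : m ≤ k) : I.drops k m = [] := by
  simp [drops, Nat.sub_eq_zero_of_le h]

theorem picks_cons {k m : ℕ} (h : k < m) :
    I.picks k m = ⟨I.pos k, Task.pick⟩ :: I.picks (k + 1) m := by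
  rw [picks, picks, show m - k = (m - (k + 1)) + 1 by omega, List.range'_succ]
  simp

theorem drops_cons {k m : ℕ} (h : k < m) :
    I.drops k m = ⟨I.slot k, Task.drop⟩ :: I.drops (k + 1) m := by
  rw [drops, drops, show m - k = (m - (k + 1)) + 1 by omega, List.range'_succ]
  simp

theorem range'_split {k l m : ℕ} (h1 : k ≤ l) (h2 : l ≤ m) :
    List.range' k (m - k) = List.range' k (l - k) ++ List.range' l (m - l) := by
  rw [show m - k = (l - k) + (m - l) by omega, ← List.range'_append, one_mul,
    Nat.add_sub_cancel' h1]

theorem picks_append {k l m : ℕ} (h1 : k ≤ l) (h2 : l ≤ m) :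
    I.picks k m = I.picks k l ++ I.picks l m := by
  simp only [picks, range'_split h1 h2, List.map_append]

theorem drops_append {k l m : ℕ} (h1 : k ≤ l) (h2 : l ≤ m) :
    I.drops k m = I.drops k l ++ I.drops l m := by
  simp only [drops, range'_split h1 h2, List.map_append]

theorem drops_reverse_succ {k m : ℕ} (h : k ≤ m) :
    (I.drops k (m + 1)).reverse = ⟨I.slot m, Task.drop⟩ :: (I.drops k m).reverse := by
  rw [I.drops_append h (Nat.le_succ m), I.drops_cons (Nat.lt_succ_self m),
    I.drops_of_le le_rfl]
  simp

theorem mem_picks {k m : ℕ} {l : Leg} :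
    l ∈ I.picks k m ↔ ∃ i, k ≤ i ∧ i < m ∧ l = ⟨I.pos i, Task.pick⟩ := by
  simp only [picks, List.mem_map, List.mem_range'_1]
  constructor
  · rintro ⟨i, hi, rfl⟩
    exact ⟨i, by omega, by omega, rfl⟩
  · rintro ⟨i, hi, hm, rfl⟩
    exact ⟨i, by omega, rfl⟩

theorem mem_drops {k m : ℕ} {l : Leg} :
    l ∈ I.drops k m ↔ ∃ i, k ≤ i ∧ i < m ∧ l = ⟨I.slot i, Task.drop⟩ := by
  simp only [drops, List.mem_map, List.mem_range'_1]
  constructor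
  · rintro ⟨i, hi, rfl⟩
    exact ⟨i, by omega, by omega, rfl⟩
  · rintro ⟨i, hi, hm, rfl⟩
    exact ⟨i, by omega, rfl⟩

/-- The triple for the sensors `k, …, j`. -/
def triple (k j : ℕ) : List Leg :=
  I.picks k (j + 1) ++ (I.drops k (j + 1)).reverse ++ [⟨I.pos j, Task.pass⟩]

/-- The condition for a final double. -/
def DoubleCond (t T : ℝ) (k j : ℕ) : Prop :=
  T + I.r + 3 * (I.pos j - I.spot k) - (I.pos j - t) > I.L - t

/-- The length of the trajectory in the current epoch after a triple and a walk in surplus. -/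
def nextT (T : ℝ) (k j m : ℕ) : ℝ :=
  T + I.r + 3 * (I.pos j - I.spot k) + (I.spot m - I.r - I.pos j)

theorem walkInSurplus_none {k : ℕ} (h : I.firstDeficit k = none) :
    I.walkInSurplus k = (I.surplusLegs k I.needed, none) := by
  unfold walkInSurplus
  rw [h]

theorem walkInSurplus_some {k m : ℕ} (h : I.firstDeficit k = some m) :
    I.walkInSurplus k = (I.surplusLegs k m ++ [⟨I.spot m, Task.pass⟩], some m) := by
  unfold walkInSurplus
  rw [h]

theorem loop_double {t T : ℝ} {k j : ℕ} (hj : I.firstLeftTurn k = some j)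
    (h : I.DoubleCond t T k j) :
    I.loop t T k = I.picks k I.sensors.length ++ (I.drops k I.needed).reverse := by
  rw [loop]
  split
  · simp_all
  · rename_i j' hj'
    obtain rfl : j = j' := by simpa [hj] using hj'
    exact if_pos h

theorem loop_triple {t T : ℝ} {k j : ℕ} (hj : I.firstLeftTurn k = some j)
    (h : ¬ I.DoubleCond t T k j) :
    I.loop t T k = I.triple k j ++ (I.walkInSurplus (j + 1)).1 ++
      match (I.walkInSurplus (j + 1)).2 with
      | none => []
      | some m => if I.nextT T k j m / (I.spot m - I.r - t) ≤ 5 / 2 then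
          I.loop (I.spot m - I.r) 0 m else I.loop t (I.nextT T k j m) m := by
  rw [loop]
  split
  · simp_all
  · rename_i j' hj'
    obtain rfl : j = j' := by simpa [hj] using hj'
    refine (if_neg h).trans ?_
    congr 1
    (split <;> rename_i heq <;> simp only [heq]); rfl

/-! ### Execution of the algorithm -/

/-- The initial positions of the sensors `k, …, m - 1`. -/
def atPos (k m : ℕ) : Multiset ℝ := ((List.range' k (m - k)).map I.pos : List ℝ)

/-- The slots of the sensors `k, …, m - 1`. -/
noncomputable def atSlots (k m : ℕ) : Multiset ℝ := ((List.range' k (m - k)).map I.slot : List ℝ)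

theorem atPos_of_le {k m : ℕ} (h : m ≤ k) : I.atPos k m = 0 := by
  simp [atPos, Nat.sub_eq_zero_of_le h]

theorem atSlots_of_le {k m : ℕ} (h : m ≤ k) : I.atSlots k m = 0 := by
  simp [atSlots, Nat.sub_eq_zero_of_le h]

theorem atPos_cons {k m : ℕ} (h : k < m) : I.atPos k m = I.pos k ::ₘ I.atPos (k + 1) m := by
  rw [atPos, atPos, show m - k = (m - (k + 1)) + 1 by omega, List.range'_succ]
  simp

theorem atPos_append {k l m : ℕ} (h1 : k ≤ l) (h2 : l ≤ m) :
    I.atPos k m = I.atPos k l + I.atPos l m := by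
  simp only [atPos, range'_split h1 h2, List.map_append, Multiset.coe_add]

theorem atSlots_append {k l m : ℕ} (h1 : k ≤ l) (h2 : l ≤ m) :
    I.atSlots k m = I.atSlots k l + I.atSlots l m := by
  simp only [atSlots, range'_split h1 h2, List.map_append, Multiset.coe_add]

theorem atSlots_cons {k m : ℕ} (h : k < m) : I.atSlots k m = I.slot k ::ₘ I.atSlots (k + 1) m := by
  rw [atSlots, atSlots, show m - k = (m - (k + 1)) + 1 by omega, List.range'_succ]
  simp

theorem atSlots_succ {k m : ℕ} (h : k ≤ m) :
    I.atSlots k (m + 1) = I.slot m ::ₘ I.atSlots k m := by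
  rw [I.atSlots_append h (Nat.le_succ m), I.atSlots_cons (Nat.lt_succ_self m),
    I.atSlots_of_le le_rfl, add_comm]
  rfl

theorem atPos_zero_length : I.atPos 0 I.sensors.length = (I.sensors : Multiset ℝ) := by
  rw [atPos]
  congr 1
  refine List.ext_getElem (by simp) fun i h1 h2 => ?_
  simp [I.pos_eq_getElem h2]

theorem run_picks {k m : ℕ} (hkm : k ≤ m) (hm : m ≤ I.sensors.length) (c : ℕ) (R : Multiset ℝ) :
    Run I.L ⟨c, I.atPos k m + R⟩ (I.picks k m) ⟨c + (m - k), R⟩ := by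
  obtain ⟨d, rfl⟩ := Nat.exists_eq_add_of_le hkm
  induction d generalizing k c with
  | zero =>
    rw [I.atPos_of_le (by omega), I.picks_of_le (by omega), zero_add]
    simpa using Run.nil _
  | succ d ih =>
    rw [I.atPos_cons (by omega), I.picks_cons (by omega), Multiset.cons_add]
    have hk : k < I.sensors.length := by omega
    refine .cons _ _ _ _ _ (.pick _ _ _ (I.pos_nonneg hk)
      (by linarith [I.pos_lt hk, I.r_pos])) ?_
    have := ih (k := k + 1) (c + 1) (by omega) (by omega)
    rw [show k + 1 + d = k + (d + 1) by omega] at this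
    rwa [show c + (k + (d + 1) - k) = c + 1 + (k + (d + 1) - (k + 1)) by omega]

theorem run_drops_reverse {k m : ℕ} (hkm : k ≤ m) (c : ℕ) (R : Multiset ℝ) :
    Run I.L ⟨c + (m - k), R⟩ (I.drops k m).reverse ⟨c, I.atSlots k m + R⟩ := by
  induction m, hkm using Nat.le_induction generalizing R with
  | base =>
    rw [I.atSlots_of_le le_rfl, I.drops_of_le le_rfl, zero_add]
    simpa using Run.nil _
  | succ m hkm ih =>
    rw [I.drops_reverse_succ hkm, I.atSlots_succ hkm, show c + (m + 1 - k) = c + (m - k) + 1 by omega]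
    refine .cons _ _ _ _ _ (.drop _ _ _ (I.slot_nonneg m)
      (by linarith [I.slot_le m, I.r_pos])) ?_
    convert ih (I.slot m ::ₘ R) using 2
    simp

theorem run_merge {a b m : ℕ} (ham : a ≤ m) (hba : b ≤ a) (hm : m ≤ I.sensors.length)
    (h : ∀ i, b ≤ i → i < m → I.pos i ≤ I.slot i) (R : Multiset ℝ) :
    Run I.L ⟨a - b, I.atPos a m + R⟩
      (List.merge (I.picks a m) (I.drops b m) fun x y => decide (x.dest ≤ y.dest))
      ⟨0, I.atSlots b m + R⟩ := by
  obtain ⟨d, hd⟩ : ∃ d, d = (m - a) + (m - b) := ⟨_, rfl⟩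
  induction d generalizing a b R with
  | zero =>
    rw [I.atPos_of_le (by omega), I.atSlots_of_le (by omega), I.picks_of_le (by omega),
      I.drops_of_le (by omega), show a - b = 0 by omega, List.nil_merge]
    exact Run.nil _
  | succ d ih =>
    have dropStep : b < a → Run I.L ⟨a - b, I.atPos a m + R⟩
        (⟨I.slot b, Task.drop⟩ ::
          List.merge (I.picks a m) (I.drops (b + 1) m) fun x y => decide (x.dest ≤ y.dest))
        ⟨0, I.atSlots b m + R⟩ := by
      intro hlt
      rw [show a - b = (a - (b + 1)) + 1 by omega]
      refine .cons _ _ _ _ _ (.drop _ _ _ (I.slot_nonneg b)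
        (by linarith [I.slot_le b, I.r_pos])) ?_
      have := ih ham hlt (fun i hi => h i (by omega)) (I.slot b ::ₘ R) (by omega)
      rw [I.atSlots_cons (by omega)]
      simpa using this
    rcases ham.eq_or_lt with rfl | ham'
    · rw [I.picks_of_le le_rfl, List.nil_merge, I.drops_cons (by omega)]
      have := dropStep (by omega)
      rwa [I.picks_of_le le_rfl, List.nil_merge] at this
    · rw [I.picks_cons ham', I.drops_cons (by omega), List.cons_merge_cons]
      by_cases hle : I.pos a ≤ I.slot b
      · rw [if_pos (by simpa using hle), I.atPos_cons ham', Multiset.cons_add]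
        have ha : a < I.sensors.length := by omega
        refine .cons _ _ _ _ _ (.pick _ _ _ (I.pos_nonneg ha)
          (by linarith [I.pos_lt ha, I.r_pos])) ?_
        have := ih (a := a + 1) (b := b) (by omega) (by omega) h R (by omega)
        rw [I.drops_cons (by omega)] at this
        rwa [show a - b + 1 = a + 1 - b by omega]
      · rw [if_neg (by simpa using hle), ← I.picks_cons ham']
        refine dropStep (lt_of_le_of_ne hba ?_)
        rintro rfl
        exact hle (h b le_rfl ham')

/-- The sensors before `k` are in their slots, the other ones in their initial positions. -/
noncomputable def settled (k : ℕ) : State := ⟨0, I.atSlots 0 k + I.atPos k I.sensors.length⟩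

theorem settled_eq_atPos {k m : ℕ} (hkm : k ≤ m) (hm : m ≤ I.sensors.length) :
    I.settled k = ⟨0, I.atPos k m + (I.atSlots 0 k + I.atPos m I.sensors.length)⟩ := by
  rw [settled, I.atPos_append hkm hm, add_left_comm]

theorem settled_eq_atSlots {k m : ℕ} (hkm : k ≤ m) :
    I.settled m = ⟨0, I.atSlots k m + (I.atSlots 0 k + I.atPos m I.sensors.length)⟩ := by
  rw [settled, I.atSlots_append (Nat.zero_le k) hkm, add_assoc, add_left_comm]

theorem run_surplusLegs {k m : ℕ} (hkm : k ≤ m) (hm : m ≤ I.sensors.length)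
    (h : ∀ i, k ≤ i → i < m → 0 ≤ I.balance i) :
    Run I.L (I.settled k) (I.surplusLegs k m) (I.settled m) := by
  have := I.run_merge hkm le_rfl hm (fun i h1 h2 => I.pos_le_slot (by omega) (h i h1 h2))
    (I.atSlots 0 k + I.atPos m I.sensors.length)
  rw [Nat.sub_self] at this
  rw [I.settled_eq_atPos hkm hm, I.settled_eq_atSlots hkm]
  exact this

theorem run_walkInSurplus {k : ℕ} (hk : k < I.needed) :
    Run I.L (I.settled k) (I.walkInSurplus k).1
      (I.settled ((I.walkInSurplus k).2.getD I.needed)) := by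
  cases h : I.firstDeficit k with
  | none =>
    rw [I.walkInSurplus_none h]
    exact I.run_surplusLegs hk.le I.needed_le_length fun i h1 h2 =>
      I.firstDeficit_none h h1 (h2.trans_le I.needed_le_length)
  | some m =>
    rw [I.walkInSurplus_some h]
    obtain ⟨h1, h2, h3, h4⟩ := I.firstDeficit_some h
    have h5 := I.spot_lt_of_balance_neg h2 h3
    refine (I.run_surplusLegs h1 h2.le h4).append (.cons _ _ _ _ _ (.pass _ _ _ ?_ ?_) (.nil _))
    · exact I.r_pos.le.trans (I.r_le_spot m)
    · linarith [h5.2.1, I.r_pos]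

theorem run_triple {k j : ℕ} (hkj : k ≤ j) (hj : j < I.sensors.length) :
    Run I.L (I.settled k) (I.triple k j) (I.settled (j + 1)) := by
  have h1 := I.run_picks (show k ≤ j + 1 by omega) hj 0
    (I.atSlots 0 k + I.atPos (j + 1) I.sensors.length)
  have h2 := I.run_drops_reverse (show k ≤ j + 1 by omega) 0
    (I.atSlots 0 k + I.atPos (j + 1) I.sensors.length)
  have h3 : Run I.L (I.settled (j + 1)) [⟨I.pos j, Task.pass⟩] (I.settled (j + 1)) :=
    .cons _ _ _ _ _ (.pass _ _ _ (I.pos_nonneg hj) (by linarith [I.pos_lt hj, I.r_pos])) (.nil _)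
  refine Run.append ?_ h3
  rw [I.settled_eq_atPos (show k ≤ j + 1 by omega) hj,
    I.settled_eq_atSlots (show k ≤ j + 1 by omega)]
  exact h1.append h2

theorem run_double {k : ℕ} (hk : k ≤ I.needed) :
    Run I.L (I.settled k) (I.picks k I.sensors.length ++ (I.drops k I.needed).reverse)
      ⟨I.sensors.length - I.needed, I.atSlots 0 I.needed⟩ := by
  have hn := I.needed_le_length
  have h1 := I.run_picks (hk.trans hn) le_rfl 0 (I.atSlots 0 k)
  have h2 := I.run_drops_reverse hk (I.sensors.length - I.needed) (I.atSlots 0 k)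
  rw [show I.sensors.length - I.needed + (I.needed - k) = 0 + (I.sensors.length - k) by omega] at h2
  rw [settled, add_comm (I.atSlots 0 k), I.atSlots_append (Nat.zero_le k) hk,
    add_comm (I.atSlots 0 k)]
  exact h1.append h2

theorem run_loop {t T : ℝ} {k : ℕ} (hk : k < I.sensors.length) (hb : I.balance k < 0) :
    ∃ s, Run I.L (I.settled k) (I.loop t T k) s ∧ I.atSlots 0 I.needed ≤ s.ground := by
  obtain ⟨d, hd⟩ : ∃ d, d = I.sensors.length - k := ⟨_, rfl⟩
  induction d using Nat.strong_induction_on generalizing t T k with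
  | _ d ih =>
    obtain ⟨j, hj⟩ := I.exists_firstLeftTurn hk hb
    obtain ⟨⟨hkj, hjn⟩, -, hjN, -⟩ := I.firstLeftTurn_spec hj hb
    by_cases hc : I.DoubleCond t T k j
    · rw [I.loop_double hj hc]
      exact ⟨_, I.run_double (by omega), le_rfl⟩
    · rw [I.loop_triple hj hc]
      have h1 := (I.run_triple hkj hjn).append (I.run_walkInSurplus hjN)
      cases hm : I.firstDeficit (j + 1) with
      | none =>
        rw [I.walkInSurplus_none hm] at h1 ⊢
        exact ⟨_, by simpa using h1, by simp [settled]⟩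
      | some m =>
        rw [I.walkInSurplus_some hm] at h1 ⊢
        obtain ⟨h2, h3, h4, -⟩ := I.firstDeficit_some hm
        dsimp only at h1 ⊢
        split_ifs
        · obtain ⟨s, h5, h6⟩ := ih _ (by omega) h3 h4 (t := I.spot m - I.r) (T := 0) rfl
          exact ⟨s, h1.append h5, h6⟩
        · obtain ⟨s, h5, h6⟩ := ih _ (by omega) h3 h4 (t := t) (T := I.nextT T k j m) rfl
          exact ⟨s, h1.append h5, h6⟩

theorem covers_atSlots : Covers I.L I.r (I.atSlots 0 I.needed) := by
  intro z h0 hL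
  have hr := I.r_pos
  have mem : ∀ i < I.needed, I.slot i ∈ I.atSlots 0 I.needed := by
    intro i hi
    simp only [atSlots, Multiset.mem_coe, List.mem_map, List.mem_range'_1]
    exact ⟨i, by omega, rfl⟩
  by_cases hz : I.L - 2 * I.r ≤ z
  · refine ⟨_, mem (I.needed - 1) (by have := I.needed_pos; omega), ?_, ?_⟩ <;>
    rw [slot_needed_sub_one] <;> linarith
  · set i := ⌊z / (2 * I.r)⌋₊ with hi
    have h1 : (i : ℝ) * (2 * I.r) ≤ z := by
      rw [← le_div_iff₀ (by linarith)]
      exact Nat.floor_le (by positivity)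
    have h2 : z < (i + 1 : ℝ) * (2 * I.r) := by
      rw [← div_lt_iff₀ (by linarith)]
      exact Nat.lt_floor_add_one _
    have h3 : I.spot i ≤ I.L - I.r := by
      unfold spot
      linarith
    refine ⟨_, mem i (I.lt_needed_iff.2 (by linarith)), ?_, ?_⟩ <;>
    rw [I.slot_eq_spot h3, spot] <;> linarith

theorem settled_zero : I.settled 0 = ⟨0, (I.sensors : Multiset ℝ)⟩ := by
  rw [settled, I.atSlots_of_le le_rfl, zero_add, I.atPos_zero_length]

theorem restoresCoverage_of_run {u : List Leg} {s : State} (h : Run I.L (I.settled 0) u s)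
    (h' : I.atSlots 0 I.needed ≤ s.ground) : RestoresCoverage I u := by
  refine ⟨s, I.settled_zero ▸ h, fun z h0 hL => ?_⟩
  obtain ⟨x, hx, h2⟩ := I.covers_atSlots z h0 hL
  exact ⟨x, Multiset.mem_of_le h' hx, h2⟩

end Inst

theorem restoresCoverage_adaptiveOnline (I : Inst) : RestoresCoverage I (adaptiveOnline I) := by
  have h1 := I.run_walkInSurplus I.needed_pos
  unfold adaptiveOnline
  cases hm : I.firstDeficit 0 with
  | none =>
    rw [I.walkInSurplus_none hm] at h1 ⊢
    exact I.restoresCoverage_of_run (by simpa using h1) (by simp [Inst.settled])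
  | some m =>
    rw [I.walkInSurplus_some hm] at h1 ⊢
    obtain ⟨h2, h3, h4, -⟩ := I.firstDeficit_some hm
    obtain ⟨s, h5, h6⟩ := I.run_loop (t := I.spot m - I.r) (T := 0) h3 h4
    exact I.restoresCoverage_of_run (h1.append h5) h6


/-! ### The algorithm is online -/

theorem takeWhile_append_of_exists {α : Type*} {p : α → Bool} {u : List α} (v : List α)
    (h : ∃ x ∈ u, p x = false) : (u ++ v).takeWhile p = u.takeWhile p := by
  obtain ⟨x, hx, hp⟩ := h
  induction u with
  | nil => simp at hx
  | cons a u ih =>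
    rcases List.mem_cons.1 hx with rfl | hx
    · simp [hp]
    · simp [List.takeWhile_cons, ih hx]

theorem takeWhile_append_of_forall {α : Type*} {p : α → Bool} (u : List α) {v : List α}
    (h : ∀ x ∈ v, p x = false) : (u ++ v).takeWhile p = u.takeWhile p := by
  induction u with
  | nil =>
    cases v with
    | nil => rfl
    | cons a v => simp [h a]
  | cons a u ih => simp [List.takeWhile_cons, ih]

theorem takeWhile_append_congr {α : Type*} {p : α → Bool} (u : List α) {v w : List α}
    (h : v.takeWhile p = w.takeWhile p) : (u ++ v).takeWhile p = (u ++ w).takeWhile p := by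
  rw [List.takeWhile_append, List.takeWhile_append, h]

theorem takeWhile_merge (y : ℝ) (u v : List Leg) :
    (List.merge u v fun a b => decide (a.dest ≤ b.dest)).takeWhile (fun l => decide (l.dest ≤ y)) =
      List.merge (u.takeWhile fun l => decide (l.dest ≤ y))
        (v.takeWhile fun l => decide (l.dest ≤ y)) fun a b => decide (a.dest ≤ b.dest) := by
  induction u generalizing v with
  | nil => simp
  | cons a u ihu =>
    induction v with
    | nil => simp
    | cons b v ihv =>
      rw [List.cons_merge_cons]
      by_cases hab : a.dest ≤ b.dest
      · rw [if_pos (by simpa using hab)]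
        by_cases ha : a.dest ≤ y
        · have h := ihu (b :: v)
          by_cases hb : b.dest ≤ y
          · simp only [List.takeWhile_cons, ha, hb, decide_true, if_true] at h ⊢
            rw [h, List.cons_merge_cons, if_pos (by simpa using hab)]
          · simp only [List.takeWhile_cons, ha, hb, decide_true, decide_false, if_true,
              Bool.false_eq_true, if_false, List.merge_right] at h ⊢
            rw [h]
        · have hb : ¬ b.dest ≤ y := fun hb => ha (hab.trans hb)
          simp [ha, hb]
      · rw [if_neg (by simpa using hab)]
        by_cases hb : b.dest ≤ y
        · by_cases ha : a.dest ≤ y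
          · simp only [List.takeWhile_cons, ha, hb, decide_true, if_true] at ihv ⊢
            rw [ihv, List.cons_merge_cons, if_neg (by simpa using hab)]
          · simp only [List.takeWhile_cons, ha, hb, decide_true, decide_false, if_true,
              Bool.false_eq_true, if_false, List.nil_merge] at ihv ⊢
            rw [ihv]
        · have ha : ¬ a.dest ≤ y := fun ha => hb ((not_le.1 hab).le.trans ha)
          simp [ha, hb]

theorem filter_append_filter_of_sorted {l : List ℝ} (h : l.Pairwise (· ≤ ·)) (y : ℝ) :
    l.filter (fun x => decide (x ≤ y)) ++ l.filter (fun x => decide (y < x)) = l := by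
  induction l with
  | nil => rfl
  | cons a l ih =>
    rw [List.pairwise_cons] at h
    by_cases ha : a ≤ y
    · rw [List.filter_cons_of_pos (by simpa using ha), List.filter_cons_of_neg (by simpa using ha),
        List.cons_append, ih h.2]
    · rw [List.filter_cons_of_neg (by simpa using ha), List.filter_cons_of_pos (by simpa using ha)]
      have h1 : l.filter (fun x => decide (x ≤ y)) = [] := by
        rw [List.filter_eq_nil_iff]
        intro x hx
        simpa using (not_le.1 ha).trans_le (h.1 x hx)
      have h2 := ih h.2
      rw [h1, List.nil_append] at h2 ⊢
      rw [h2]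

/-- The inputs `I` and `J` have the same barrier and range, and exactly the first `N` sensors of
each lie in `[0, y]`, at the same positions. -/
structure Agree (I J : Inst) (y : ℝ) (N : ℕ) : Prop where
  L_eq : I.L = J.L
  r_eq : I.r = J.r
  lt_end : y < I.L - I.r
  pos_eq : ∀ i < N, I.pos i = J.pos i
  pos_le : ∀ i < N, I.pos i ≤ y
  le_left : N ≤ I.sensors.length
  le_right : N ≤ J.sensors.length
  lt_left : ∀ i, N ≤ i → i < I.sensors.length → y < I.pos i
  lt_right : ∀ i, N ≤ i → i < J.sensors.length → y < J.pos i

namespace Agree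

variable {I J : Inst} {y : ℝ} {N : ℕ}

theorem of_filter_eq (hL : I.L = J.L) (hr : I.r = J.r) (hy : y < I.L - I.r)
    (h : I.sensors.filter (fun x => decide (x ≤ y)) = J.sensors.filter (fun x => decide (x ≤ y))) :
    Agree I J y (I.sensors.filter (fun x => decide (x ≤ y))).length := by
  have key : ∀ K : Inst, ∃ t : List ℝ, K.sensors =
      K.sensors.filter (fun x => decide (x ≤ y)) ++ t ∧ ∀ x ∈ t, y < x := fun K =>
    ⟨_, (filter_append_filter_of_sorted K.sorted y).symm, fun x hx => by simpa using (List.mem_filter.1 hx).2⟩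
  have hle : ∀ x ∈ I.sensors.filter (fun x => decide (x ≤ y)), x ≤ y := fun x hx => by simp_all
  obtain ⟨s, hs, hs'⟩ := key I
  obtain ⟨t, ht, ht'⟩ := key J
  rw [← h] at ht
  generalize I.sensors.filter (fun x => decide (x ≤ y)) = σ at *
  have posl : ∀ K : Inst, ∀ v, K.sensors = σ ++ v → ∀ i, ∀ hi : i < σ.length, K.pos i = σ[i] := by
    intro K v hv i hi
    unfold Inst.pos
    rw [hv, List.getD_append _ _ _ _ hi, List.getD_eq_getElem _ _ hi]
  have posr : ∀ K : Inst, ∀ v, K.sensors = σ ++ v → (∀ x ∈ v, y < x) → ∀ i, σ.length ≤ i →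
      i < K.sensors.length → y < K.pos i := by
    intro K v hv hv' i hi hin
    have h2 : i - σ.length < v.length := by
      rw [hv, List.length_append] at hin
      omega
    unfold Inst.pos
    rw [hv, List.getD_append_right _ _ _ _ hi, List.getD_eq_getElem _ _ h2]
    exact hv' _ (List.getElem_mem h2)
  exact ⟨hL, hr, hy, fun i hi => by rw [posl I s hs i hi, posl J t ht i hi],
    fun i hi => by rw [posl I s hs i hi]; exact hle _ (List.getElem_mem hi),
    by rw [hs]; simp, by rw [ht]; simp, posr I s hs hs', posr J t ht ht'⟩

theorem symm (h : Agree I J y N) : Agree J I y N where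
  L_eq := h.L_eq.symm
  r_eq := h.r_eq.symm
  lt_end := by rw [← h.L_eq, ← h.r_eq]; exact h.lt_end
  pos_eq i hi := (h.pos_eq i hi).symm
  pos_le i hi := by rw [← h.pos_eq i hi]; exact h.pos_le i hi
  le_left := h.le_right
  le_right := h.le_left
  lt_left := h.lt_right
  lt_right := h.lt_left

theorem spot_eq (h : Agree I J y N) : I.spot = J.spot := by
  funext i
  simp only [Inst.spot, h.r_eq]

theorem slot_eq (h : Agree I J y N) : I.slot = J.slot := by
  funext i
  simp only [Inst.slot, h.spot_eq, h.r_eq, h.L_eq]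

theorem needed_eq (h : Agree I J y N) : I.needed = J.needed := by
  simp only [Inst.needed, h.r_eq, h.L_eq]

theorem balance_eq (h : Agree I J y N) {i : ℕ} (hi : i < N) : I.balance i = J.balance i := by
  simp only [Inst.balance, h.spot_eq, h.pos_eq i hi]

theorem picks_eq (h : Agree I J y N) (k : ℕ) {m : ℕ} (hm : m ≤ N) :
    I.picks k m = J.picks k m := by
  unfold Inst.picks
  refine List.map_congr_left fun i hi => ?_
  rw [List.mem_range'_1] at hi
  rw [h.pos_eq i (by omega)]

theorem drops_eq (h : Agree I J y N) : I.drops = J.drops := by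
  funext k m
  simp only [Inst.drops, h.slot_eq]

theorem leftTurn_of (h : Agree I J y N) {i : ℕ} (hi : i < N) (hl : I.LeftTurn i) :
    J.LeftTurn i := by
  unfold Inst.LeftTurn at hl ⊢
  rw [← h.balance_eq hi, ← h.r_eq]
  refine hl.imp_right ?_
  rintro ⟨h1, h2, h3⟩
  have h4 : i + 1 < N := by
    by_contra hc
    have := h.lt_left (i + 1) (by omega) h2
    linarith [h.pos_le i hi]
  exact ⟨h1, by linarith [h.le_right], by rw [← h.pos_eq _ h4, ← h.pos_eq _ hi, h3]⟩

theorem firstLeftTurn_eq (h : Agree I J y N) {k j : ℕ} (hj : j < N)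
    (hI : I.firstLeftTurn k = some j) : J.firstLeftTurn k = some j := by
  rw [Inst.firstLeftTurn_eq_some] at hI ⊢
  obtain ⟨h1, h2, h3⟩ := hI
  exact ⟨⟨h1.1, hj.trans_le h.le_right⟩, h.leftTurn_of hj h2,
    fun i hi hij hl => h3 i hi hij (h.symm.leftTurn_of (hij.trans hj) hl)⟩

theorem takeWhile_picks (h : Agree I J y N) (k : ℕ) {m : ℕ} (hm : N ≤ m)
    (hn : m ≤ I.sensors.length) :
    (I.picks k m).takeWhile (fun l => decide (l.dest ≤ y)) =
      (I.picks k N).takeWhile (fun l => decide (l.dest ≤ y)) := by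
  have fail : ∀ k' ≥ N, ∀ l ∈ I.picks k' m, decide (l.dest ≤ y) = false := by
    intro k' hk' l hl
    obtain ⟨i, hi, him, rfl⟩ := I.mem_picks.1 hl
    simpa using h.lt_left i (by omega) (by omega)
  rcases le_total k N with hk | hk
  · rw [I.picks_append hk hm, takeWhile_append_of_forall _ (fail N le_rfl)]
  · rw [I.picks_of_le hk]
    exact takeWhile_append_of_forall [] (fail k hk)

theorem takeWhile_walkInSurplus (h : Agree I J y N) {k : ℕ} (hkN : k ≤ N) (hk : k < I.needed)
    (hN : N ≤ I.needed) (hb : ∀ i, k ≤ i → i < N → 0 ≤ I.balance i) (hy : y < I.spot N) :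
    (I.walkInSurplus k).1.takeWhile (fun l => decide (l.dest ≤ y)) =
      (I.surplusLegs k N).takeWhile (fun l => decide (l.dest ≤ y)) ∧
    ∃ l ∈ (I.walkInSurplus k).1, decide (l.dest ≤ y) = false := by
  have fail : ∀ m, ∀ l ∈ I.drops N m, decide (l.dest ≤ y) = false := by
    intro m l hl
    obtain ⟨i, hi, him, rfl⟩ := I.mem_drops.1 hl
    have h1 : y < I.slot i := lt_min (hy.trans_le (I.spot_mono hi)) h.lt_end
    simpa using h1
  have last : ∃ l ∈ I.drops k I.needed, y < l.dest :=
    ⟨_, I.mem_drops.2 ⟨I.needed - 1, by omega, by omega, rfl⟩,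
      by rw [I.slot_needed_sub_one]; exact h.lt_end⟩
  have key : ∀ m, N ≤ m → m ≤ I.sensors.length →
      (I.surplusLegs k m).takeWhile (fun l => decide (l.dest ≤ y)) =
        (I.surplusLegs k N).takeWhile (fun l => decide (l.dest ≤ y)) := by
    intro m hm hn
    unfold Inst.surplusLegs
    rw [takeWhile_merge, takeWhile_merge, h.takeWhile_picks k hm hn, I.drops_append hkN hm,
      takeWhile_append_of_forall _ (fail m)]
  cases hm : I.firstDeficit k with
  | some m =>
    rw [I.walkInSurplus_some hm]
    obtain ⟨h1, h2, h3, -⟩ := I.firstDeficit_some hm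
    have hNm : N ≤ m := by
      by_contra hc
      exact absurd (hb m h1 (by omega)) (by linarith)
    have h4 : y < I.spot m := hy.trans_le (I.spot_mono hNm)
    refine ⟨?_, _, List.mem_append_right _ (List.mem_singleton_self _), by simpa using h4⟩
    dsimp only
    rw [takeWhile_append_of_forall, key m hNm h2.le]
    simpa using h4
  | none =>
    rw [I.walkInSurplus_none hm]
    obtain ⟨l, hl, hly⟩ := last
    exact ⟨key _ hN I.needed_le_length, l, List.mem_merge_right _ hl, by simpa using hly⟩

/-- Both walks in surplus are the same, or they are the same up to leaving `[0, y]`. -/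
theorem walkInSurplus_eq (h : Agree I J y N) {k : ℕ} (hkN : k ≤ N) (hk : k < I.needed) :
    I.walkInSurplus k = J.walkInSurplus k ∨
    ((I.walkInSurplus k).1.takeWhile (fun l => decide (l.dest ≤ y)) =
      (J.walkInSurplus k).1.takeWhile (fun l => decide (l.dest ≤ y)) ∧
    (∃ l ∈ (I.walkInSurplus k).1, decide (l.dest ≤ y) = false) ∧
    ∃ l ∈ (J.walkInSurplus k).1, decide (l.dest ≤ y) = false) := by
  have legs : ∀ m ≤ N, I.surplusLegs k m = J.surplusLegs k m := fun m hm => by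
    simp only [Inst.surplusLegs, h.picks_eq k hm, h.drops_eq]
  have same : ∀ m ≤ N, I.firstDeficit k = some m → J.firstDeficit k = some m →
      I.walkInSurplus k = J.walkInSurplus k := fun m hm h1 h2 => by
    rw [I.walkInSurplus_some h1, J.walkInSurplus_some h2, legs m hm, h.spot_eq]
  by_cases hb : ∀ i, k ≤ i → i < N → 0 ≤ I.balance i
  · have hb' : ∀ i, k ≤ i → i < N → 0 ≤ J.balance i := fun i h1 h2 => by
      rw [← h.balance_eq h2]
      exact hb i h1 h2
    rcases lt_or_ge I.needed N with hN | hN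
    · left
      have none_of : ∀ K : Inst, (∀ i, k ≤ i → i < N → 0 ≤ K.balance i) → K.needed < N →
          K.firstDeficit k = none := by
        intro K hK hKN
        cases hm : K.firstDeficit k with
        | none => rfl
        | some m =>
          obtain ⟨h1, h2, h3, -⟩ := K.firstDeficit_some hm
          have h4 := (K.spot_lt_of_balance_neg h2 h3).2.2
          exact absurd (hK m h1 (by omega)) (by linarith)
      rw [I.walkInSurplus_none (none_of I hb hN),
        J.walkInSurplus_none (none_of J hb' (h.needed_eq ▸ hN)), ← h.needed_eq, legs _ hN.le]
    · rcases lt_or_ge y (I.spot N) with hy | hy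
      · right
        obtain ⟨h1, h2⟩ := h.takeWhile_walkInSurplus hkN hk hN hb hy
        obtain ⟨h3, h4⟩ := h.symm.takeWhile_walkInSurplus hkN (h.needed_eq ▸ hk)
          (h.needed_eq ▸ hN) hb' (h.spot_eq ▸ hy)
        exact ⟨by rw [h1, h3, legs N le_rfl], h2, h4⟩
      · left
        have some_of : ∀ K : Inst, (∀ i, k ≤ i → i < N → 0 ≤ K.balance i) → y < K.L - K.r →
            K.spot N ≤ y → (∀ i, N ≤ i → i < K.sensors.length → y < K.pos i) →
            K.firstDeficit k = some N := by
          intro K hK h1 h2 h3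
          have h4 : N < K.sensors.length := by
            have := K.lt_needed_of_spot_lt (h2.trans_lt h1)
            have := K.needed_le_length
            omega
          refine K.firstDeficit_eq_some hkN h4 ?_ hK
          unfold Inst.balance
          linarith [h3 N le_rfl h4]
        exact same N le_rfl (some_of I hb h.lt_end hy h.lt_left)
          (some_of J hb' h.symm.lt_end (h.spot_eq ▸ hy) h.lt_right)
  · left
    push Not at hb
    obtain ⟨i, hki, hiN, hi⟩ := hb
    cases hm : I.firstDeficit k with
    | none => exact absurd (I.firstDeficit_none hm hki (hiN.trans_le h.le_left)) (by linarith)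
    | some m =>
      obtain ⟨h1, h2, h3, h4⟩ := I.firstDeficit_some hm
      have h5 : m < N := by
        by_contra hc
        exact absurd (h4 i hki (by omega)) (by linarith)
      refine same m h5.le hm (J.firstDeficit_eq_some h1 (h5.trans_le h.le_right) ?_ ?_)
      · rwa [← h.balance_eq h5]
      · intro i' hi' him
        rw [← h.balance_eq (him.trans h5)]
        exact h4 i' hi' him

theorem takeWhile_loop_none (h : Agree I J y N) {t T : ℝ} {k j : ℕ}
    (hj : I.firstLeftTurn k = some j) (hNj : N ≤ j) :
    (I.loop t T k).takeWhile (fun l => decide (l.dest ≤ y)) =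
      (I.picks k N).takeWhile (fun l => decide (l.dest ≤ y)) := by
  obtain ⟨⟨hkj, hjn⟩, -⟩ := I.firstLeftTurn_eq_some.1 hj
  have mem : ∀ m, j < m → ∃ l ∈ I.picks k m, decide (l.dest ≤ y) = false := fun m hm =>
    ⟨_, I.mem_picks.2 ⟨j, hkj, hm, rfl⟩, by simpa using h.lt_left j hNj hjn⟩
  by_cases hc : I.DoubleCond t T k j
  · rw [I.loop_double hj hc, takeWhile_append_of_exists _ (mem _ hjn),
      h.takeWhile_picks k h.le_left le_rfl]
  · rw [I.loop_triple hj hc, Inst.triple]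
    simp only [List.append_assoc]
    rw [takeWhile_append_of_exists _ (mem _ (Nat.lt_succ_self j)),
      h.takeWhile_picks k (by omega) hjn]

theorem takeWhile_loop (h : Agree I J y N) {t T : ℝ} {k : ℕ} (hkI : k < I.sensors.length)
    (hkJ : k < J.sensors.length) (hbI : I.balance k < 0) (hbJ : J.balance k < 0) :
    (I.loop t T k).takeWhile (fun l => decide (l.dest ≤ y)) =
      (J.loop t T k).takeWhile (fun l => decide (l.dest ≤ y)) := by
  obtain ⟨d, hd⟩ : ∃ d, d = I.sensors.length - k := ⟨_, rfl⟩
  induction d using Nat.strong_induction_on generalizing t T k with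
  | _ d ih =>
    obtain ⟨j, hj⟩ := I.exists_firstLeftTurn hkI hbI
    obtain ⟨j', hj'⟩ := J.exists_firstLeftTurn hkJ hbJ
    have hkn : k < I.needed := by
      have := (I.spot_lt_of_balance_neg hkI hbI).2.2
      omega
    have hkn' : k < J.needed := h.needed_eq ▸ hkn
    rcases le_or_gt N j with hNj | hjN
    · have hNj' : N ≤ j' := by
        by_contra hc
        have := h.symm.firstLeftTurn_eq (not_le.1 hc) hj'
        rw [hj, Option.some_inj] at this
        omega
      rw [h.takeWhile_loop_none hj hNj, h.symm.takeWhile_loop_none hj' hNj',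
        h.picks_eq k le_rfl]
    · have hj2 := h.firstLeftTurn_eq hjN hj
      obtain ⟨⟨hkj, hjn⟩, -, hjneed, -⟩ := I.firstLeftTurn_spec hj hbI
      have hc : I.DoubleCond t T k j ↔ J.DoubleCond t T k j := by
        simp only [Inst.DoubleCond, h.L_eq, h.r_eq, h.pos_eq j hjN, h.spot_eq]
      by_cases hcI : I.DoubleCond t T k j
      · rw [I.loop_double hj hcI, J.loop_double hj2 (hc.1 hcI)]
        have key : ∀ K : Inst, ∀ u : List Leg, y < K.L - K.r → k < K.needed →
            (u ++ (K.drops k K.needed).reverse).takeWhile (fun l => decide (l.dest ≤ y)) =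
              u.takeWhile (fun l => decide (l.dest ≤ y)) := by
          intro K u hy hk
          have h1 : K.needed = (K.needed - 1) + 1 := by omega
          have h2 : decide (K.slot (K.needed - 1) ≤ y) = false := by
            rw [K.slot_needed_sub_one]
            exact decide_eq_false (not_le.2 hy)
          rw [h1, K.drops_reverse_succ (by omega)]
          generalize (K.drops k (K.needed - 1)).reverse = v
          induction u with
          | nil => rw [List.nil_append, List.takeWhile_cons, h2]; rfl
          | cons a u ih => simp only [List.cons_append, List.takeWhile_cons, ih]
        rw [key I _ h.lt_end hkn, key J _ h.symm.lt_end hkn',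
          h.takeWhile_picks k h.le_left le_rfl, h.symm.takeWhile_picks k h.le_right le_rfl,
          h.picks_eq k le_rfl]
      · rw [I.loop_triple hj hcI, J.loop_triple hj2 (fun h' => hcI (hc.2 h'))]
        have htr : I.triple k j = J.triple k j := by
          simp only [Inst.triple, h.picks_eq k (show j + 1 ≤ N from hjN), h.drops_eq,
            h.pos_eq j hjN]
        rw [htr]
        rcases h.walkInSurplus_eq (show j + 1 ≤ N from hjN) hjneed with heq | ⟨h1, h2, h3⟩
        · rw [heq]
          cases hm : I.firstDeficit (j + 1) with
          | none =>
            rw [I.walkInSurplus_none hm] at heq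
            rw [← heq]
          | some m =>
            rw [I.walkInSurplus_some hm] at heq
            obtain ⟨hm1, hm2, hm3, -⟩ := I.firstDeficit_some hm
            cases hm' : J.firstDeficit (j + 1) with
            | none =>
              rw [J.walkInSurplus_none hm'] at heq
              simp at heq
            | some m' =>
              rw [J.walkInSurplus_some hm'] at heq ⊢
              obtain rfl : m = m' := by simpa using congrArg Prod.snd heq
              obtain ⟨hm1', hm2', hm3', -⟩ := J.firstDeficit_some hm'
              have hT : J.nextT T k j m = I.nextT T k j m := by
                simp only [Inst.nextT, h.r_eq, h.pos_eq j hjN, h.spot_eq]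
              dsimp only
              rw [hT, ← h.spot_eq, ← h.r_eq]
              refine takeWhile_append_congr _ ?_
              split_ifs <;> exact ih _ (by omega) hm2 hm2' hm3 hm3' rfl
        · rw [List.append_assoc, List.append_assoc]
          refine takeWhile_append_congr _ ?_
          rw [takeWhile_append_of_exists _ h2, takeWhile_append_of_exists _ h3, h1]

theorem takeWhile_adaptiveOnline (h : Agree I J y N) :
    (adaptiveOnline I).takeWhile (fun l => decide (l.dest ≤ y)) =
      (adaptiveOnline J).takeWhile (fun l => decide (l.dest ≤ y)) := by
  unfold adaptiveOnline
  rcases h.walkInSurplus_eq (Nat.zero_le N) I.needed_pos with heq | ⟨h1, h2, h3⟩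
  · rw [heq]
    cases hm : I.firstDeficit 0 with
    | none =>
      rw [I.walkInSurplus_none hm] at heq
      rw [← heq]
    | some m =>
      rw [I.walkInSurplus_some hm] at heq
      obtain ⟨-, hm2, hm3, -⟩ := I.firstDeficit_some hm
      cases hm' : J.firstDeficit 0 with
      | none =>
        rw [J.walkInSurplus_none hm'] at heq
        simp at heq
      | some m' =>
        rw [J.walkInSurplus_some hm'] at heq ⊢
        obtain rfl : m = m' := by simpa using congrArg Prod.snd heq
        obtain ⟨-, hm2', hm3', -⟩ := J.firstDeficit_some hm'
        dsimp only
        rw [← h.spot_eq, ← h.r_eq]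
        exact takeWhile_append_congr _ (h.takeWhile_loop hm2 hm2' hm3 hm3')
  · rw [takeWhile_append_of_exists _ h2, takeWhile_append_of_exists _ h3, h1]

end Agree

theorem nonAnticipating_adaptiveOnline : NonAnticipating adaptiveOnline := by
  intro I J y hL hr hf p hp hpy
  rcases lt_or_ge y (I.L - I.r) with hy | hy
  · have h := (Agree.of_filter_eq hL hr hy hf).takeWhile_adaptiveOnline
    obtain ⟨s, hs⟩ := hp
    have h1 : p <+: (adaptiveOnline I).takeWhile (fun l => decide (l.dest ≤ y)) := by
      rw [← hs, List.takeWhile_append_of_pos (fun l hl => by simpa using hpy l hl)]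
      exact List.prefix_append _ _
    rw [h] at h1
    exact h1.trans (List.takeWhile_prefix _)
  · have all : ∀ K : Inst, K.L - K.r ≤ y →
        K.sensors.filter (fun x => decide (x ≤ y)) = K.sensors := by
      intro K hK
      rw [List.filter_eq_self]
      intro x hx
      have h1 : x ≤ y := by linarith [K.end_uncovered x hx]
      simpa using h1
    rw [all I hy, all J (by rw [← hL, ← hr]; exact hy)] at hf
    obtain rfl : I = J := by
      cases I
      cases J
      simp_all
    exact hp

theorem isOnlineAlgorithm_adaptiveOnline : IsOnlineAlgorithm adaptiveOnline :=
  ⟨nonAnticipating_adaptiveOnline, restoresCoverage_adaptiveOnline⟩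


/-! ### Deficit along the trajectory of the algorithm -/

theorem getElem_lt_iff_lt_countP {l : List ℝ} (h : l.Pairwise (· ≤ ·)) (z : ℝ) {i : ℕ}
    (hi : i < l.length) : l[i] < z ↔ i < l.countP (fun x => decide (x < z)) := by
  induction l generalizing i with
  | nil => simp at hi
  | cons a l ih =>
    rw [List.pairwise_cons] at h
    by_cases ha : a < z
    · rw [List.countP_cons_of_pos (by simpa using ha)]
      cases i with
      | zero => simpa using ha
      | succ i =>
        rw [List.getElem_cons_succ, ih h.2 (by simpa using hi)]
        omega
    · rw [List.countP_cons_of_neg (by simpa using ha)]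
      have h1 : l.countP (fun x => decide (x < z)) = 0 := by
        rw [List.countP_eq_zero]
        intro x hx
        simpa using (not_lt.1 ha).trans (h.1 x hx)
      rw [h1]
      cases i with
      | zero => simpa using ha
      | succ i =>
        rw [List.getElem_cons_succ, ih h.2 (by simpa using hi), h1]
        omega

namespace Inst

variable (I : Inst)

theorem pos_lt_iff {i : ℕ} (hi : i < I.sensors.length) (z : ℝ) :
    I.pos i < z ↔ i < I.numLeft z := by
  rw [I.pos_eq_getElem hi, getElem_lt_iff_lt_countP I.sorted z hi]
  rfl

theorem Ioc_subset_deficitSet {k j : ℕ} (hj : I.firstLeftTurn k = some j)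
    (hk : I.balance k < 0) : Ioc (I.spot k) (I.pos j) ⊆ I.deficitSet := by
  intro z hz
  obtain ⟨h1, h2, h3⟩ := I.firstLeftTurn_eq_some.1 hj
  have h4 : I.numLeft z ≤ j := by
    by_contra hc
    exact absurd ((I.pos_lt_iff h1.2 z).2 (not_le.1 hc)) (not_lt.2 hz.2)
  rcases le_or_gt (I.numLeft z) k with h5 | h5
  · exact (I.spot_mono h5).trans_lt hz.1
  · obtain ⟨i, hi⟩ : ∃ i, I.numLeft z = i + 1 := ⟨I.numLeft z - 1, by omega⟩
    have h6 := (I.deficit_of_not_leftTurn h1.2 hk h3 (i := i) (by omega) (by omega)).2 (by omega)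
    have h7 := (I.pos_lt_iff (i := i) (by omega) z).2 (by omega)
    change I.spot (I.numLeft z) < z
    rw [hi]
    linarith [h6.1]

theorem notMem_deficitSet {k m : ℕ} (hm : m ≤ I.sensors.length)
    (h : ∀ i, k ≤ i → i < m → 0 ≤ I.balance i) {z : ℝ} (hk : k ≤ I.numLeft z)
    (hz : z ≤ I.spot m) : z ∉ I.deficitSet := by
  change ¬ I.spot (I.numLeft z) < z
  rw [not_lt]
  rcases le_or_gt m (I.numLeft z) with h1 | h1
  · exact hz.trans (I.spot_mono h1)
  · have h2 : ¬ I.pos (I.numLeft z) < z := by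
      rw [I.pos_lt_iff (by omega)]
      omega
    exact (not_lt.1 h2).trans (I.pos_le_spot (h _ hk h1))

theorem L_le_spot_length : I.L ≤ I.spot I.sensors.length := by
  unfold spot
  linarith [I.enough, I.r_pos]

end Inst

/-! ### Lengths of the parts of the trajectory -/

theorem lengthFrom_ascending {u : List Leg} (v : List Leg) {q e : ℝ} (hqe : q ≤ e)
    (hu : u.Pairwise fun a b => a.dest ≤ b.dest) (h : ∀ l ∈ u, q ≤ l.dest ∧ l.dest ≤ e) :
    lengthFrom q (u ++ v) ≤ e - q + lengthFrom e v := by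
  induction u generalizing q with
  | nil =>
    have := lengthFrom_le_abs_add q e v
    rwa [abs_of_nonneg (by linarith)] at this
  | cons a u ih =>
    rw [List.pairwise_cons] at hu
    have h1 := h a List.mem_cons_self
    have := ih h1.2 hu.2 fun l hl => ⟨hu.1 l hl, (h l (List.mem_cons_of_mem _ hl)).2⟩
    rw [List.cons_append, lengthFrom, abs_of_nonneg (by linarith)]
    linarith

theorem lengthFrom_descending {u : List Leg} (v : List Leg) {q e : ℝ} (hqe : e ≤ q)
    (hu : u.Pairwise fun a b => b.dest ≤ a.dest) (h : ∀ l ∈ u, e ≤ l.dest ∧ l.dest ≤ q) :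
    lengthFrom q (u ++ v) ≤ q - e + lengthFrom e v := by
  induction u generalizing q with
  | nil =>
    have := lengthFrom_le_abs_add q e v
    rwa [abs_of_nonpos (by linarith), neg_sub] at this
  | cons a u ih =>
    rw [List.pairwise_cons] at hu
    have h1 := h a List.mem_cons_self
    have := ih h1.1 hu.2 fun l hl => ⟨(h l (List.mem_cons_of_mem _ hl)).1, hu.1 l hl⟩
    rw [List.cons_append, lengthFrom, abs_of_nonpos (by linarith)]
    linarith

namespace Inst

variable (I : Inst)

theorem pairwise_picks {k m : ℕ} (hm : m ≤ I.sensors.length) :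
    (I.picks k m).Pairwise fun a b => a.dest ≤ b.dest := by
  unfold picks
  rw [List.pairwise_map]
  refine (List.pairwise_lt_range' (s := k) (n := m - k)).imp_of_mem fun {a b} ha hb hab => ?_
  rw [List.mem_range'_1] at hb
  exact I.pos_mono hab.le (by omega)

theorem pairwise_drops (k m : ℕ) : (I.drops k m).Pairwise fun a b => a.dest ≤ b.dest := by
  unfold drops
  rw [List.pairwise_map]
  exact (List.pairwise_lt_range' (s := k) (n := m - k)).imp fun hab => I.slot_mono hab.le

theorem pairwise_drops_reverse (k m : ℕ) :
    (I.drops k m).reverse.Pairwise fun a b => b.dest ≤ a.dest :=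
  List.pairwise_reverse.2 (I.pairwise_drops k m)

theorem lengthFrom_surplusLegs_le {k m : ℕ} (hm : m ≤ I.sensors.length)
    (h : ∀ i, k ≤ i → i < m → 0 ≤ I.balance i) (v : List Leg) {q e : ℝ} (hqe : q ≤ e)
    (hpos : ∀ i, k ≤ i → i < m → q ≤ I.pos i) (hslot : ∀ i, k ≤ i → i < m → I.slot i ≤ e) :
    lengthFrom q (I.surplusLegs k m ++ v) ≤ e - q + lengthFrom e v := by
  have hle : ∀ i, k ≤ i → i < m → I.pos i ≤ I.slot i := fun i h1 h2 =>
    I.pos_le_slot (by omega) (h i h1 h2)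
  refine lengthFrom_ascending v hqe ?_ ?_
  · have := List.pairwise_merge (le := fun a b : Leg => decide (a.dest ≤ b.dest))
      (fun a b c h1 h2 => by
        simp only [decide_eq_true_eq] at *
        exact h1.trans h2)
      (fun a b => by simpa using le_total a.dest b.dest) (I.picks k m) (I.drops k m)
      ((I.pairwise_picks hm).imp fun h => by simpa using h)
      ((I.pairwise_drops k m).imp fun h => by simpa using h)
    exact this.imp fun h => by simpa using h
  · intro l hl
    rcases List.mem_merge.1 hl with hl | hl
    · obtain ⟨i, hi, him, rfl⟩ := I.mem_picks.1 hl
      exact ⟨hpos i hi him, (hle i hi him).trans (hslot i hi him)⟩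
    · obtain ⟨i, hi, him, rfl⟩ := I.mem_drops.1 hl
      exact ⟨(hpos i hi him).trans (hle i hi him), hslot i hi him⟩

theorem lengthFrom_walk_none_le {k : ℕ} (h : I.firstDeficit k = none) {q : ℝ}
    (hq : q ≤ I.L - I.r) (hpos : ∀ i, k ≤ i → i < I.sensors.length → q ≤ I.pos i) :
    lengthFrom q (I.surplusLegs k I.needed) ≤ I.L - I.r - q := by
  have hn := I.needed_le_length
  have := I.lengthFrom_surplusLegs_le hn
    (fun i h1 h2 => I.firstDeficit_none h h1 (h2.trans_le hn)) [] hq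
    (fun i h1 h2 => hpos i h1 (h2.trans_le hn)) (fun i _ _ => I.slot_le i)
  simpa [lengthFrom] using this

theorem lengthFrom_walk_some_le {k m : ℕ} (h : I.firstDeficit k = some m) (v : List Leg) {q : ℝ}
    (hq : q ≤ I.spot m) (hpos : ∀ i, k ≤ i → i < I.sensors.length → q ≤ I.pos i) :
    lengthFrom q (I.surplusLegs k m ++ [⟨I.spot m, Task.pass⟩] ++ v) ≤
      I.spot m - q + lengthFrom (I.spot m) v := by
  obtain ⟨h1, h2, h3, h4⟩ := I.firstDeficit_some h
  have := I.lengthFrom_surplusLegs_le h2.le h4 (⟨I.spot m, Task.pass⟩ :: v) hq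
    (fun i h5 h6 => hpos i h5 (h6.trans h2))
    (fun i _ h6 => (min_le_left _ _).trans (I.spot_mono h6.le))
  rw [List.append_assoc]
  simpa [lengthFrom] using this

theorem lengthFrom_triple_le {k j : ℕ} (hj : I.firstLeftTurn k = some j) (hk : I.balance k < 0)
    (v : List Leg) :
    lengthFrom (I.spot k) (I.triple k j ++ v) ≤
      3 * (I.pos j - I.spot k) + lengthFrom (I.pos j) v := by
  obtain ⟨⟨hkj, hjn⟩, h1, h2, h3⟩ := I.firstLeftTurn_spec hj hk
  have h4 := I.spot_lt_of_balance_neg (hkj.trans_lt hjn) hk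
  have h5 := I.spot_lt_of_balance_neg hjn h1
  have hup := lengthFrom_ascending (u := I.picks k (j + 1))
    ((I.drops k (j + 1)).reverse ++ ⟨I.pos j, Task.pass⟩ :: v) h3.le (I.pairwise_picks hjn) (by
      intro l hl
      obtain ⟨i, hi, him, rfl⟩ := I.mem_picks.1 hl
      exact ⟨h4.1.le.trans (I.pos_mono hi (by omega)), I.pos_mono (by omega) hjn⟩)
  have hdown := lengthFrom_descending (u := (I.drops k (j + 1)).reverse)
    (⟨I.pos j, Task.pass⟩ :: v) h3.le (I.pairwise_drops_reverse k (j + 1)) (by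
      intro l hl
      obtain ⟨i, hi, him, rfl⟩ := I.mem_drops.1 (List.mem_reverse.1 hl)
      refine ⟨?_, (min_le_left _ _).trans ((I.spot_mono (by omega)).trans h5.1.le)⟩
      rw [← I.slot_eq_spot h4.2.1.le]
      exact I.slot_mono hi)
  rw [triple]
  simp only [List.append_assoc, List.cons_append, List.nil_append]
  rw [lengthFrom, abs_of_nonneg (by linarith)] at hdown
  linarith

theorem lengthFrom_double_le {k : ℕ} {q : ℝ} (hq : q ≤ I.L - I.r)
    (hpos : ∀ i, k ≤ i → i < I.sensors.length → q ≤ I.pos i) (hslot : I.slot k ≤ I.L - I.r) :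
    lengthFrom q (I.picks k I.sensors.length ++ (I.drops k I.needed).reverse) ≤
      (I.L - I.r - q) + (I.L - I.r - I.slot k) := by
  have hup := lengthFrom_ascending (u := I.picks k I.sensors.length)
    (I.drops k I.needed).reverse hq (I.pairwise_picks le_rfl) (by
      intro l hl
      obtain ⟨i, hi, him, rfl⟩ := I.mem_picks.1 hl
      exact ⟨hpos i hi him, (I.pos_lt him).le⟩)
  have hdown := lengthFrom_descending (u := (I.drops k I.needed).reverse) [] hslot
    (I.pairwise_drops_reverse k I.needed) (by
      intro l hl
      obtain ⟨i, hi, him, rfl⟩ := I.mem_drops.1 (List.mem_reverse.1 hl)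
      exact ⟨I.slot_mono hi, I.slot_le i⟩)
  rw [List.append_nil, lengthFrom] at hdown
  linarith

/-! ### The competitive ratio -/

theorem length_loop_le {O t T : ℝ} {k : ℕ} (hk : k < I.sensors.length) (hb : I.balance k < 0)
    (ht : 0 ≤ t) (htk : t + I.r ≤ I.spot k)
    (hT : T = I.spot k - (t + I.r) + 2 * (I.deficit (I.spot k) - I.deficit (t + I.r)))
    (hhalf : 2 * (I.deficit (I.spot k) - I.deficit (t + I.r)) ≤
      I.L - I.r - (t + I.r) + 2 * I.r)
    (hdense : 3 / 4 * (I.spot k - (t + I.r)) ≤ I.deficit (I.spot k) - I.deficit (t + I.r))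
    (hO : (∃ e, I.spot k ≤ e ∧ e ≤ I.L - I.r ∧
        2 * (I.L - I.r) - e + 2 * I.deficit e ≤ O) ∨
      ∃ e, I.r ≤ e ∧ e ≤ I.spot k ∧ 2 * (I.L - I.r) - e + 2 * I.deficit e ≤ O ∧
        3 / 4 * (e - (t + I.r)) ≤ I.deficit e - I.deficit (t + I.r)) :
    I.spot k + 2 * I.deficit (I.spot k) + lengthFrom (I.spot k) (I.loop t T k) ≤
      5 / 4 * O + 3 / 4 * I.r := by
  obtain ⟨n, hn⟩ : ∃ n, n = I.sensors.length - k := ⟨_, rfl⟩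
  induction n using Nat.strong_induction_on generalizing t T k with
  | _ n ih =>
    obtain ⟨j, hj⟩ := I.exists_firstLeftTurn hk hb
    obtain ⟨⟨hkj, hjn⟩, hjb, hjN, hba⟩ := I.firstLeftTurn_spec hj hb
    have hr := I.r_pos
    have hrb := I.r_le_spot k
    have haM := I.pos_lt hjn
    have hda := I.deficit_sub_eq_of_subset (hr.le.trans hrb) hba.le
      (I.Ioc_subset_deficitSet hj hb)
    have hpb0 := I.deficit_mono (by linarith) htk
    have hpb1 := I.deficit_sub_le (by linarith) htk
    have hp0 := I.deficit_nonneg (t + I.r)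
    have hposk : ∀ i, k ≤ i → i < I.sensors.length → I.spot k ≤ I.pos i := fun i h1 h2 =>
      (I.spot_lt_of_balance_neg hk hb).1.le.trans (I.pos_mono h1 h2)
    have hposj : ∀ i, j + 1 ≤ i → i < I.sensors.length → I.pos j ≤ I.pos i := fun i h1 h2 =>
      I.pos_mono (by omega) h2
    have hleft : ∀ z, I.pos j < z → j + 1 ≤ I.numLeft z := fun z hz => (I.pos_lt_iff hjn z).1 hz
    replace hO : (∃ e, I.pos j ≤ e ∧ e ≤ I.L - I.r ∧
        2 * (I.L - I.r) - e + 2 * I.deficit e ≤ O) ∨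
      ∃ e, I.r ≤ e ∧ e ≤ I.spot k ∧ 2 * (I.L - I.r) - e + 2 * I.deficit e ≤ O ∧
        3 / 4 * (e - (t + I.r)) ≤ I.deficit e - I.deficit (t + I.r) := by
      rcases hO with ⟨e, h1, h2, h3⟩ | h
      · rcases le_total (I.pos j) e with h4 | h4
        · exact .inl ⟨e, h4, h2, h3⟩
        · refine .inr ⟨I.spot k, hrb, le_rfl, ?_, hdense⟩
          have h5 := I.deficit_sub_eq_of_subset (hr.le.trans hrb) h1
            ((Ioc_subset_Ioc_right h4).trans (I.Ioc_subset_deficitSet hj hb))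
          linarith
      · exact .inr h
    have hcond : I.DoubleCond t T k j ↔ I.L - I.r - (t + I.r) + 2 * I.r <
        2 * (I.deficit (I.pos j) - I.deficit (t + I.r)) := by
      unfold DoubleCond
      constructor <;> intro h <;> linarith
    by_cases hc : I.DoubleCond t T k j
    · rw [I.loop_double hj hc]
      have hslot : I.slot k = I.spot k := I.slot_eq_spot (by linarith)
      have hlen := I.lengthFrom_double_le (by linarith) hposk (I.slot_le k)
      rw [hslot] at hlen
      rw [hcond] at hc
      rcases hO with ⟨e, h1, h2, h3⟩ | ⟨e, h1, h2, h3, h4⟩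
      · have h5 := I.deficit_mono (by linarith) h1
        linarith
      · have h5 := I.deficit_nonneg e
        linarith
    · rw [I.loop_triple hj hc]
      rw [hcond, not_lt] at hc
      cases hm : I.firstDeficit (j + 1) with
      | none =>
        rw [I.walkInSurplus_none hm]
        dsimp only
        rw [List.append_nil]
        have hlen := I.lengthFrom_triple_le hj hb (I.surplusLegs (j + 1) I.needed)
        have hlen' := I.lengthFrom_walk_none_le hm haM.le hposj
        have hflat : ∀ e, I.pos j ≤ e → e ≤ I.L - I.r → I.deficit e = I.deficit (I.pos j) := by
          intro e h1 h2
          refine I.deficit_eq_of_disjoint (by linarith) h1 fun z hz => ?_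
          exact I.notMem_deficitSet le_rfl (fun i h3 h4 => I.firstDeficit_none hm h3 h4)
            (hleft z hz.1) (by linarith [I.L_le_spot_length, hz.2])
        rcases hO with ⟨e, h1, h2, h3⟩ | ⟨e, h1, h2, h3, h4⟩
        · have h5 := hflat e h1 h2
          have h6 := I.deficit_nonneg e
          linarith
        · have h5 := I.deficit_nonneg e
          linarith
      | some m =>
        rw [I.walkInSurplus_some hm]
        obtain ⟨hm1, hm2, hm3, hm4⟩ := I.firstDeficit_some hm
        have hax : I.pos j ≤ I.spot m := by
          refine le_trans ?_ (I.spot_mono hm1)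
          rw [I.spot_succ]
          have := (I.firstLeftTurn_eq_some.1 hj).2.1
          unfold LeftTurn balance at this
          rcases this with h | h <;> linarith [h.1]
        have hxM := (I.spot_lt_of_balance_neg hm2 hm3).2.1
        have hflat : ∀ e, I.pos j ≤ e → e ≤ I.spot m →
            I.deficit e = I.deficit (I.pos j) := by
          intro e h1 h2
          refine I.deficit_eq_of_disjoint (by linarith) h1 fun z hz => ?_
          exact I.notMem_deficitSet hm2.le hm4 (hleft z hz.1) (hz.2.trans h2)
        have hx := hflat _ hax le_rfl
        have hO' : ((∃ e, I.spot m ≤ e ∧ e ≤ I.L - I.r ∧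
              2 * (I.L - I.r) - e + 2 * I.deficit e ≤ O) ∨
            ∃ e, I.r ≤ e ∧ e ≤ I.spot m ∧ 2 * (I.L - I.r) - e + 2 * I.deficit e ≤ O ∧
              3 / 4 * (e - (t + I.r)) ≤ I.deficit e - I.deficit (t + I.r)) := by
          rcases hO with ⟨e, h1, h2, h3⟩ | ⟨e, h1, h2, h3, h4⟩
          · rcases le_total (I.spot m) e with h5 | h5
            · exact .inl ⟨e, h5, h2, h3⟩
            · refine .inl ⟨I.spot m, le_rfl, hxM.le, ?_⟩
              rw [hx, ← hflat e h1 h5]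
              linarith
          · exact .inr ⟨e, h1, by linarith, h3, h4⟩
        have key : ∀ v : List Leg, lengthFrom (I.spot k) (I.triple k j ++
            (I.surplusLegs (j + 1) m ++ [⟨I.spot m, Task.pass⟩]) ++ v) ≤
            3 * (I.pos j - I.spot k) + (I.spot m - I.pos j) + lengthFrom (I.spot m) v := by
          intro v
          have h1 := I.lengthFrom_triple_le hj hb
            (I.surplusLegs (j + 1) m ++ [⟨I.spot m, Task.pass⟩] ++ v)
          have h2 := I.lengthFrom_walk_some_le hm v hax hposj
          rw [List.append_assoc]
          linarith
        have hT2 : I.nextT T k j m = I.spot m - (t + I.r) +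
            2 * (I.deficit (I.spot m) - I.deficit (t + I.r)) := by
          unfold nextT
          linarith
        have hden : 0 < I.spot m - I.r - t := by linarith
        dsimp only
        split_ifs with hif
        · rw [div_le_iff₀ hden] at hif
          have h1 := ih _ (by omega) (t := I.spot m - I.r) (T := 0) hm2 hm3
            (by linarith [I.r_le_spot m]) (by linarith) (by rw [sub_add_cancel]; ring)
            (by rw [sub_add_cancel]; linarith) (by rw [sub_add_cancel]; simp) (by
              refine hO'.imp_right ?_
              rintro ⟨e, h1, h2, h3, h4⟩
              refine ⟨e, h1, h2, h3, ?_⟩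
              rw [sub_add_cancel]
              linarith) rfl
          have h2 := key (I.loop (I.spot m - I.r) 0 m)
          linarith
        · rw [not_le, lt_div_iff₀ hden] at hif
          have h1 := ih _ (by omega) (t := t) (T := I.nextT T k j m) hm2 hm3 ht (by linarith) hT2
            (by rw [hx]; exact hc) (by linarith) hO' rfl
          have h2 := key (I.loop t (I.nextT T k j m) m)
          linarith

theorem length_adaptiveOnline_le {O e : ℝ} (heM : e ≤ I.L - I.r)
    (he : 2 * (I.L - I.r) - e + 2 * I.deficit e ≤ O) :
    trajLength (adaptiveOnline I) ≤ 5 / 4 * O + 3 / 4 * I.r := by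
  have hr := I.r_pos
  have hrL := I.r_lt_L
  have hd := I.deficit_nonneg e
  unfold trajLength adaptiveOnline
  cases hm : I.firstDeficit 0 with
  | none =>
    rw [I.walkInSurplus_none hm]
    dsimp only
    rw [List.append_nil]
    have := I.lengthFrom_walk_none_le hm (q := 0) (by linarith) fun i _ h => I.pos_nonneg h
    linarith
  | some m =>
    rw [I.walkInSurplus_some hm]
    dsimp only
    obtain ⟨-, hm2, hm3, hm4⟩ := I.firstDeficit_some hm
    have hrx := I.r_le_spot m
    have hxM := (I.spot_lt_of_balance_neg hm2 hm3).2.1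
    have hlen := I.lengthFrom_walk_some_le hm (I.loop (I.spot m - I.r) 0 m) (q := 0)
      (by linarith) fun i _ h => I.pos_nonneg h
    have hx : I.deficit (I.spot m) = 0 := by
      rw [I.deficit_eq_of_disjoint le_rfl (hr.le.trans hrx) fun z hz =>
        I.notMem_deficitSet hm2.le hm4 (Nat.zero_le _) hz.2, deficit_zero]
    have h1 := I.length_loop_le (O := O) (t := I.spot m - I.r) (T := 0) hm2 hm3 (by linarith)
      (by linarith) (by rw [sub_add_cancel]; ring) (by rw [sub_add_cancel]; linarith)
      (by rw [sub_add_cancel]; simp) (by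
        left
        rcases le_total (I.spot m) e with h | h
        · exact ⟨e, h, heM, he⟩
        · exact ⟨I.spot m, le_rfl, hxM.le, by linarith⟩)
    linarith

end Inst

theorem le_optLength {I : Inst} {c : ℝ}
    (h : ∀ u, RestoresCoverage I u → c ≤ trajLength u) : c ≤ optLength I :=
  le_csInf ⟨_, _, restoresCoverage_adaptiveOnline I, rfl⟩ fun _ ⟨u, hu, hT⟩ => hT ▸ h u hu

theorem optLength_le {I : Inst} {u : List Leg} (h : RestoresCoverage I u) :
    optLength I ≤ trajLength u :=
  csInf_le ⟨0, fun _ ⟨_, _, hT⟩ => hT ▸ lengthFrom_nonneg _ _⟩ ⟨u, h, rfl⟩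

theorem length_adaptiveOnline_le_optLength (I : Inst) :
    trajLength (adaptiveOnline I) ≤ 5 / 4 * optLength I + 3 / 4 * I.r := by
  have : 4 / 5 * (trajLength (adaptiveOnline I) - 3 / 4 * I.r) ≤ optLength I := by
    refine le_optLength fun u hu => ?_
    obtain ⟨e, h2, h3⟩ := hu.le_trajLength
    have := I.length_adaptiveOnline_le h2 h3
    linarith
  linarith


/-! ### The adversary against an online algorithm

The sensors have range `1 / 2` and the barrier has length `N + 1`. -/

theorem lengthFrom_le_of_prefix (q : ℝ) {p u : List Leg} (h : p <+: u) :
    lengthFrom q p ≤ lengthFrom q u := by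
  obtain ⟨s, rfl⟩ := h
  rw [lengthFrom_append]
  linarith [lengthFrom_nonneg (finalPos q p) s]

theorem optLength_nonneg (I : Inst) : 0 ≤ optLength I :=
  le_optLength fun _ _ => lengthFrom_nonneg _ _

theorem optLength_le_two_mul (I : Inst) : optLength I ≤ 2 * (I.L - I.r) := by
  have h := I.restoresCoverage_of_run (I.run_double (Nat.zero_le _)) le_rfl
  have h1 := I.lengthFrom_double_le (k := 0) (q := 0) (by linarith [I.r_lt_L])
    (fun i _ hi => I.pos_nonneg hi) (I.slot_le 0)
  have h2 := optLength_le h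
  unfold trajLength at h2
  linarith [I.slot_nonneg 0]

/-- The center of the `i`-th unit interval. -/
noncomputable def center (i : ℕ) : ℝ := i + 1 / 2

theorem center_mono : Monotone center := fun i j h => by
  have : (i : ℝ) ≤ j := by exact_mod_cast h
  unfold center
  linarith

theorem center_pos (i : ℕ) : 0 < center i := by
  unfold center
  positivity

/-- The centers with indices `a, …, b - 1`. -/
noncomputable def centers (a b : ℕ) : List ℝ := (List.range' a (b - a)).map center

theorem mem_centers {a b : ℕ} {x : ℝ} : x ∈ centers a b ↔ ∃ i, a ≤ i ∧ i < b ∧ center i = x := by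
  simp only [centers, List.mem_map, List.mem_range'_1]
  constructor
  · rintro ⟨i, hi, rfl⟩
    exact ⟨i, by omega, by omega, rfl⟩
  · rintro ⟨i, hi, hm, rfl⟩
    exact ⟨i, by omega, rfl⟩

theorem centers_append {a b c : ℕ} (h1 : a ≤ b) (h2 : b ≤ c) :
    centers a c = centers a b ++ centers b c := by
  simp only [centers, Inst.range'_split h1 h2, List.map_append]

theorem length_centers (a b : ℕ) : (centers a b).length = b - a := by simp [centers]

theorem pairwise_centers (a b : ℕ) : (centers a b).Pairwise (· ≤ ·) := by
  rw [centers, List.pairwise_map]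
  exact (List.pairwise_lt_range' (s := a) (n := b - a)).imp fun h => center_mono h.le

theorem covers_of_center_mem {N : ℕ} {g : Multiset ℝ} (h : ∀ i ≤ N, center i ∈ g) :
    Covers (N + 1) (1 / 2) g := by
  intro z h0 hz
  have h1 := Nat.floor_le h0
  have h2 := Nat.lt_floor_add_one z
  rcases le_or_gt ⌊z⌋₊ N with h3 | h3
  · refine ⟨_, h _ h3, ?_, ?_⟩ <;> unfold center <;> linarith
  · have h4 : (N : ℝ) + 1 ≤ ⌊z⌋₊ := by exact_mod_cast h3
    refine ⟨_, h _ le_rfl, ?_, ?_⟩ <;> unfold center <;> linarith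

/-- Sensors `i, …, i + q - 1` at the center with index `i + q`, and then one sensor at every
center, with one more at the last one. -/
noncomputable def block (N i q : ℕ) : List ℝ :=
  List.replicate q (center (i + q)) ++ (centers (i + q) N ++ [center (N - 1)])

theorem mem_block {N i q : ℕ} (hq : i + q < N) {x : ℝ} (hx : x ∈ block N i q) :
    center (i + q) ≤ x ∧ x ≤ center (N - 1) := by
  have h := center_mono (show i + q ≤ N - 1 by omega)
  simp only [block, List.mem_append, List.mem_replicate, mem_centers, List.mem_singleton] at hx
  rcases hx with ⟨-, rfl⟩ | ⟨j, h1, h2, rfl⟩ | rfl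
  · exact ⟨le_rfl, h⟩
  · exact ⟨center_mono h1, center_mono (by omega)⟩
  · exact ⟨h, le_rfl⟩

theorem pairwise_block {N i q : ℕ} (hq : i + q < N) : (block N i q).Pairwise (· ≤ ·) := by
  unfold block
  rw [List.pairwise_append]
  refine ⟨List.pairwise_replicate.2 (.inr le_rfl), ?_, ?_⟩
  · rw [List.pairwise_append]
    refine ⟨pairwise_centers _ _, List.pairwise_singleton _ _, ?_⟩
    intro x hx y hy
    obtain ⟨j, h1, h2, rfl⟩ := mem_centers.1 hx
    rw [List.mem_singleton.1 hy]
    exact center_mono (by omega)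
  · intro x hx y hy
    rw [(List.mem_replicate.1 hx).2]
    exact (mem_block hq (List.mem_append_right _ hy)).1

theorem exists_inst {N q : ℕ} {σ : List ℝ} (hs : σ.Pairwise (· ≤ ·)) (h0 : ∀ x ∈ σ, 0 ≤ x)
    (hlt : ∀ x ∈ σ, x < center σ.length) (hq : σ.length + q < N) :
    ∃ I : Inst, I.L = N + 1 ∧ I.r = 1 / 2 ∧ I.sensors = σ ++ block N σ.length q := by
  have hle : ∀ x ∈ σ ++ block N σ.length q, 0 ≤ x ∧ x ≤ center (N - 1) := by
    intro x hx
    rcases List.mem_append.1 hx with hx | hx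
    · exact ⟨h0 x hx, (hlt x hx).le.trans (center_mono (by omega))⟩
    · have := mem_block hq hx
      exact ⟨(center_pos _).le.trans this.1, this.2⟩
  have hlast : center (N - 1) = N - 1 / 2 := by
    unfold center
    rw [Nat.cast_sub (by omega), Nat.cast_one]
    ring
  refine ⟨⟨N + 1, 1 / 2, σ ++ block N σ.length q, by positivity, by norm_num, ?_,
    fun x hx => (hle x hx).1, fun x hx => ?_, ?_⟩, rfl, rfl, rfl⟩
  · rw [List.pairwise_append]
    refine ⟨hs, pairwise_block hq, fun x hx y hy => ?_⟩
    exact (hlt x hx).le.trans ((center_mono (Nat.le_add_right _ _)).trans (mem_block hq hy).1)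
  · linarith [(hle x hx).2]
  · have : (σ ++ block N σ.length q).length = N + 1 := by
      simp only [block, List.length_append, List.length_replicate, length_centers,
        List.length_singleton]
      omega
    rw [this]
    push_cast
    linarith

/-- Collect the `q` sensors at the center `i + q` and put them at the centers
`i + q - 1, …, i`. -/
noncomputable def fixBlock (i q : ℕ) : List Leg :=
  List.replicate q ⟨center (i + q), Task.pick⟩ ++
    (centers i (i + q)).reverse.map fun x => ⟨x, Task.drop⟩

theorem run_replicate_pick {L p : ℝ} (h0 : 0 ≤ p) (hL : p ≤ L) (q c : ℕ) (R : Multiset ℝ) :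
    Run L ⟨c, (List.replicate q p : List ℝ) + R⟩ (List.replicate q ⟨p, Task.pick⟩)
      ⟨c + q, R⟩ := by
  induction q generalizing c with
  | zero => simpa using Run.nil _
  | succ q ih =>
    rw [List.replicate_succ, List.replicate_succ, ← Multiset.cons_coe, Multiset.cons_add]
    refine .cons _ _ _ _ _ (.pick _ _ _ h0 hL) ?_
    convert ih (c + 1) using 2
    omega

theorem run_drop_list {L : ℝ} {u : List ℝ} (h : ∀ x ∈ u, 0 ≤ x ∧ x ≤ L) (R : Multiset ℝ) :
    Run L ⟨u.length, R⟩ (u.map fun x => ⟨x, Task.drop⟩) ⟨0, (u : Multiset ℝ) + R⟩ := by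
  induction u generalizing R with
  | nil => simpa using Run.nil _
  | cons a u ih =>
    have ha := h a List.mem_cons_self
    refine .cons _ _ _ _ _ (.drop _ _ _ ha.1 ha.2) ?_
    have := ih (fun x hx => h x (List.mem_cons_of_mem _ hx)) (a ::ₘ R)
    rwa [← Multiset.cons_coe, Multiset.cons_add, ← Multiset.add_cons]

theorem run_fixBlock {N i q : ℕ} (hq : i + q ≤ N) (R : Multiset ℝ) :
    Run (N + 1) ⟨0, (List.replicate q (center (i + q)) : List ℝ) + R⟩ (fixBlock i q)
      ⟨0, (centers i (i + q) : Multiset ℝ) + R⟩ := by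
  have hN : ∀ j ≤ i + q, 0 ≤ center j ∧ center j ≤ (N : ℝ) + 1 := fun j hj => by
    refine ⟨(center_pos j).le, (center_mono (hj.trans hq)).trans ?_⟩
    unfold center
    linarith
  refine (run_replicate_pick (hN _ le_rfl).1 (hN _ le_rfl).2 q 0 R).append ?_
  have h := run_drop_list (L := (N : ℝ) + 1) (u := (centers i (i + q)).reverse) (by
    intro x hx
    obtain ⟨j, h1, h2, rfl⟩ := mem_centers.1 (List.mem_reverse.1 hx)
    exact hN j h2.le) R
  rwa [List.length_reverse, length_centers, Multiset.coe_reverse,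
    show i + q - i = 0 + q by omega] at h

theorem lengthFrom_fixBlock_le (i q : ℕ) (v : List Leg) :
    lengthFrom (center i) (fixBlock i q ++ v) ≤ 2 * q + lengthFrom (center i) v := by
  have hc := center_mono (Nat.le_add_right i q)
  have hup := lengthFrom_ascending
    (u := List.replicate q ⟨center (i + q), Task.pick⟩)
    (((centers i (i + q)).reverse.map fun x => (⟨x, Task.drop⟩ : Leg)) ++ v) hc
    (List.pairwise_replicate.2 (.inr le_rfl)) (by
      intro l hl
      rw [(List.mem_replicate.1 hl).2]
      exact ⟨hc, le_rfl⟩)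
  have hdown := lengthFrom_descending
    (u := (centers i (i + q)).reverse.map fun x => (⟨x, Task.drop⟩ : Leg)) v hc (by
      rw [List.pairwise_map, List.pairwise_reverse]
      exact pairwise_centers _ _) (by
      intro l hl
      obtain ⟨x, hx, rfl⟩ := List.mem_map.1 hl
      obtain ⟨j, h1, h2, rfl⟩ := mem_centers.1 (List.mem_reverse.1 hx)
      exact ⟨center_mono h1, center_mono h2.le⟩)
  have h : center (i + q) - center i = q := by
    unfold center
    push_cast
    ring
  rw [fixBlock, List.append_assoc]
  linarith

/-- What the adversary has achieved with the initial part `σ` of an input, which contains `k`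
blocks: on every continuation, algorithm `A` first executes a plan that has walked back and forth
over most of the barrier, while `k` triples of length `q` suffice to cover it. -/
structure Forced (A : Inst → List Leg) (N q : ℕ) (σ : List ℝ) (k : ℕ) : Prop where
  sorted : σ.Pairwise (· ≤ ·)
  nonneg : ∀ x ∈ σ, 0 ≤ x
  lt_center : ∀ x ∈ σ, x < center σ.length
  mul_le : q * k ≤ σ.length
  offline : ∃ f : List Leg,
    (∀ R : Multiset ℝ, Run (N + 1) ⟨0, (σ : Multiset ℝ) + R⟩ f
      ⟨0, (centers 0 σ.length : Multiset ℝ) + R⟩) ∧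
    ∀ v, lengthFrom 0 (f ++ v) ≤ center σ.length + 2 * (q * k) + lengthFrom (center σ.length) v
  online : ∃ p : List Leg, (∀ l ∈ p, l.dest < center σ.length) ∧
    (∀ I : Inst, I.L = N + 1 → I.r = 1 / 2 → ∀ ρ, I.sensors = σ ++ ρ →
      (∀ x ∈ ρ, center σ.length ≤ x) → p <+: A I) ∧
    finalPos 0 p + 2 * (σ.length - 2 * k) ≤ lengthFrom 0 p

theorem forced_nil (A : Inst → List Leg) (N q : ℕ) : Forced A N q [] 0 where
  sorted := .nil
  nonneg := by simp
  lt_center := by simp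
  mul_le := by simp
  offline := by
    refine ⟨[], fun R => by simpa [centers] using Run.nil _, fun v => ?_⟩
    have := lengthFrom_le_abs_add 0 (center 0) v
    rw [sub_zero, abs_of_pos (center_pos 0)] at this
    simpa using this
  online := ⟨[], by simp, fun _ _ _ _ _ _ => List.nil_prefix, by simp [finalPos, lengthFrom]⟩

namespace Forced

variable {A : Inst → List Leg} {N q : ℕ} {σ : List ℝ} {k : ℕ}

/-- The gap at the beginning of a block forces the robot to return from the end of the block. -/
theorem exists_return (h : Forced A N q σ k) (hA : IsOnlineAlgorithm A) {q' : ℕ} (hq0 : 1 ≤ q')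
    (hq : σ.length + q' < N) {I : Inst} (hL : I.L = N + 1) (hr : I.r = 1 / 2)
    (hI : I.sensors = σ ++ block N σ.length q') :
    ∃ p, p <+: A I ∧ ∃ X, center (σ.length + q') ≤ X ∧ (∀ l ∈ p, l.dest ≤ X) ∧
      finalPos 0 p < center (σ.length + 1) ∧
      2 * (σ.length - 2 * k) + 2 * X ≤ lengthFrom 0 p + finalPos 0 p := by
  obtain ⟨p, hp1, hp2, hp3⟩ := h.online
  have hwi := center_mono (Nat.le_add_right σ.length q')
  have hpA := hp2 I hL hr _ hI fun x hx => hwi.trans (mem_block hq hx).1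
  have hnum : I.numLeft (center (σ.length + q')) = σ.length := by
    unfold Inst.numLeft
    rw [hI, Multiset.coe_countP, List.countP_append, List.countP_eq_length.2, List.countP_eq_zero.2,
      add_zero]
    · intro x hx
      simpa using (mem_block hq hx).1
    · intro x hx
      simpa using (h.lt_center x hx).trans_le hwi
  have hN : (σ.length : ℝ) + 1 ≤ N := by exact_mod_cast (show σ.length + 1 ≤ N by omega)
  obtain ⟨u₁, x, u₂, y, u₃, hu, hx, hy⟩ := (hA.2 I).returns
    (center_mono (show σ.length + 1 ≤ σ.length + q' by omega))
    (by rw [hL, hr]; unfold center; push_cast; linarith)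
    (by rw [hnum, hr]; unfold center; push_cast; linarith)
  have hpu : p <+: u₁ := by
    have h1 : u₁ ++ [x] <+: A I := ⟨u₂ ++ y :: u₃, by rw [hu]; simp⟩
    rcases List.prefix_or_prefix_of_prefix hpA h1 with h2 | h2
    · rcases List.prefix_concat_iff.1 h2 with rfl | h3
      · exact absurd (hp1 x (by simp)) (by linarith)
      · exact h3
    · exact absurd (hp1 x (h2.subset (by simp))) (by linarith)
  obtain ⟨s, rfl⟩ := hpu
  obtain ⟨m, hm, hmax⟩ := Set.exists_max_image {l | l ∈ p ++ s ++ x :: u₂ ++ [y]} Leg.dest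
    (List.finite_toSet _) ⟨x, by simp⟩
  have hxm : center (σ.length + q') ≤ m.dest := hx.trans (hmax x (by simp))
  have hms : m ∈ s ++ x :: u₂ ++ [y] := by
    have hm' : m ∈ p ++ (s ++ x :: u₂ ++ [y]) := by simpa using hm
    rcases List.mem_append.1 hm' with h1 | h1
    · exact absurd (hp1 m h1) (by linarith)
    · exact h1
  have hfin : finalPos 0 (p ++ (s ++ x :: u₂ ++ [y])) = y.dest := by
    rw [← List.append_assoc, finalPos_append]
    rfl
  refine ⟨p ++ (s ++ x :: u₂ ++ [y]), ⟨u₃, by rw [hu]; simp⟩, m.dest, hxm,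
    fun l hl => hmax l (by simpa using hl), by rwa [hfin], ?_⟩
  have h1 := le_lengthFrom_of_mem (q := finalPos 0 p) hms
  rw [← finalPos_append] at h1
  rw [lengthFrom_append]
  have h2 := le_abs_self (m.dest - finalPos 0 p)
  have h3 := neg_abs_le (finalPos 0 (p ++ (s ++ x :: u₂ ++ [y])) - m.dest)
  linarith

theorem optLength_le (h : Forced A N q σ k) (hq : σ.length + q < N) {I : Inst} (hL : I.L = N + 1)
    (hr : I.r = 1 / 2) (hI : I.sensors = σ ++ block N σ.length q) :
    optLength I ≤ center N + 2 * (q * (k + 1)) := by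
  obtain ⟨f, hf1, hf2⟩ := h.offline
  have hNN : center N - center (N - 1) = 1 ∧ center N ≤ (N : ℝ) + 1 := by
    unfold center
    rw [Nat.cast_sub (by omega), Nat.cast_one]
    constructor <;> linarith
  have hrun := ((hf1 (block N σ.length q)).append (v := fixBlock σ.length q)
    (s'' := ⟨0, centers σ.length (σ.length + q) + ((centers 0 σ.length : Multiset ℝ) +
      (centers (σ.length + q) N ++ [center (N - 1)] : List ℝ))⟩) (by
      have := run_fixBlock hq.le ((centers 0 σ.length : Multiset ℝ) +
        (centers (σ.length + q) N ++ [center (N - 1)] : List ℝ))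
      rwa [block, ← Multiset.coe_add, add_left_comm])).append
    (v := [⟨center (N - 1), Task.pick⟩, ⟨center N, Task.drop⟩])
    (s'' := ⟨0, center N ::ₘ (centers 0 N : Multiset ℝ)⟩) (by
      have h1 : ((centers σ.length (σ.length + q) : Multiset ℝ) +
          ((centers 0 σ.length : Multiset ℝ) +
            (centers (σ.length + q) N ++ [center (N - 1)] : List ℝ))) =
          center (N - 1) ::ₘ (centers 0 N : Multiset ℝ) := by
        rw [centers_append (Nat.zero_le σ.length) (show σ.length ≤ N by omega),
          centers_append (Nat.le_add_right σ.length q) hq.le, ← Multiset.singleton_add]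
        simp only [← Multiset.coe_add, Multiset.coe_singleton]
        abel
      rw [h1]
      exact .cons _ _ _ _ _ (.pick _ _ _ (center_pos _).le (by linarith))
        (.cons _ _ _ _ _ (.drop _ _ _ (center_pos _).le hNN.2) (.nil _)))
  have hcov : RestoresCoverage I (f ++ fixBlock σ.length q ++
      [⟨center (N - 1), Task.pick⟩, ⟨center N, Task.drop⟩]) := by
    refine ⟨_, by rw [hL, hI, ← Multiset.coe_add]; exact hrun, ?_⟩
    rw [hL, hr]
    refine covers_of_center_mem fun i hi => ?_
    dsimp only
    rw [Multiset.mem_cons, Multiset.mem_coe, mem_centers]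
    rcases hi.eq_or_lt with rfl | hi
    · exact .inl rfl
    · exact .inr ⟨i, Nat.zero_le i, hi, rfl⟩
  refine (BarrierCoverage.optLength_le hcov).trans ?_
  have h1 := hf2 (fixBlock σ.length q ++ [⟨center (N - 1), Task.pick⟩, ⟨center N, Task.drop⟩])
  have h2 := lengthFrom_fixBlock_le σ.length q
    [⟨center (N - 1), Task.pick⟩, ⟨center N, Task.drop⟩]
  have h3 := center_mono (show σ.length ≤ N - 1 by omega)
  simp only [lengthFrom] at h2
  rw [abs_of_nonneg (by linarith), abs_of_nonneg (by linarith)] at h2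
  rw [trajLength, List.append_assoc]
  linarith

/-- The next block is put where the robot has not been before its return. -/
theorem extend (h : Forced A N q σ k) (hA : IsOnlineAlgorithm A) (hq0 : 1 ≤ q)
    (hq : σ.length + q < N) {I : Inst} (hL : I.L = N + 1) (hr : I.r = 1 / 2)
    (hI : I.sensors = σ ++ block N σ.length q) {p : List Leg} (hp : p <+: A I) {X : ℝ}
    (hX : center (σ.length + q) ≤ X) (hXN : X < center (N - 2)) (hpX : ∀ l ∈ p, l.dest ≤ X)
    (hfin : finalPos 0 p < center (σ.length + 1))
    (hlen : 2 * (σ.length - 2 * k) + 2 * X ≤ lengthFrom 0 p + finalPos 0 p) :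
    ∃ σ' : List ℝ, σ.length < σ'.length ∧ σ'.length + 2 ≤ N ∧ Forced A N q σ' (k + 1) := by
  obtain ⟨j, hj1, hj2⟩ : ∃ j : ℕ, center j ≤ X ∧ X < center (j + 1) := by
    have h0 := center_pos (σ.length + q)
    have h1 : 0 ≤ X - 1 / 2 := by
      have h2 : center 0 ≤ X := (center_mono (Nat.zero_le _)).trans hX
      simp only [center, Nat.cast_zero] at h2
      linarith
    refine ⟨⌊X - 1 / 2⌋₊, ?_, ?_⟩ <;> unfold center
    · linarith [Nat.floor_le h1]
    · push_cast
      linarith [Nat.lt_floor_add_one (X - 1 / 2)]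
  have hj3 : σ.length + q < j + 1 := by
    by_contra hc
    linarith [center_mono (not_lt.1 hc)]
  have hj4 : j < N - 2 := by
    by_contra hc
    linarith [center_mono (not_lt.1 hc)]
  set σ' := σ ++ (List.replicate q (center (σ.length + q)) ++ centers (σ.length + q) (j + 1))
    with hσ'
  have hlen' : σ'.length = j + 1 := by
    simp only [hσ', List.length_append, List.length_replicate, length_centers]
    omega
  have hle : ∀ x ∈ σ', x ≤ center j ∧ 0 ≤ x := by
    intro x hx
    simp only [hσ', List.mem_append, List.mem_replicate, mem_centers] at hx
    rcases hx with hx | ⟨-, rfl⟩ | ⟨i, h1, h2, rfl⟩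
    · exact ⟨(h.lt_center x hx).le.trans (center_mono (by omega)), h.nonneg x hx⟩
    · exact ⟨center_mono (by omega), (center_pos _).le⟩
    · exact ⟨center_mono (by omega), (center_pos _).le⟩
  have hdecomp : I.sensors = σ' ++ (centers (j + 1) N ++ [center (N - 1)]) := by
    rw [hI, block, hσ', centers_append hj3.le (show j + 1 ≤ N by omega)]
    simp only [List.append_assoc]
  have hfilter : ∀ ρ : List ℝ, (∀ x ∈ ρ, center (j + 1) ≤ x) →
      (σ' ++ ρ).filter (fun x => decide (x ≤ X)) = σ' := by
    intro ρ hρ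
    rw [List.filter_append, List.filter_eq_self.2, List.filter_eq_nil_iff.2, List.append_nil]
    · intro x hx
      simpa using hj2.trans_le (hρ x hx)
    · intro x hx
      simpa using (hle x hx).1.trans hj1
  refine ⟨σ', by omega, by omega, ?_, fun x hx => (hle x hx).2, ?_, ?_, ?_, ?_⟩
  · have h1 := I.sorted
    rw [hdecomp] at h1
    exact (List.pairwise_append.1 h1).1
  · intro x hx
    rw [hlen']
    linarith [(hle x hx).1]
  · rw [hlen', mul_add]
    have := h.mul_le
    omega
  · obtain ⟨f, hf1, hf2⟩ := h.offline
    refine ⟨f ++ fixBlock σ.length q, fun R => ?_, fun v => ?_⟩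
    · have h1 := hf1 ((List.replicate q (center (σ.length + q)) : List ℝ) +
        ((centers (σ.length + q) (j + 1) : Multiset ℝ) + R))
      have h2 := run_fixBlock hq.le ((centers 0 σ.length : Multiset ℝ) +
        ((centers (σ.length + q) (j + 1) : Multiset ℝ) + R))
      rw [add_left_comm] at h2
      have h3 := h1.append h2
      rw [hlen', centers_append (Nat.zero_le σ.length) (show σ.length ≤ j + 1 by omega),
        centers_append (Nat.le_add_right σ.length q) hj3.le, hσ']
      simp only [← Multiset.coe_add, add_assoc] at h3 ⊢
      rwa [add_left_comm (centers 0 σ.length : Multiset ℝ)]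
    · have h1 := hf2 (fixBlock σ.length q ++ v)
      have h2 := lengthFrom_fixBlock_le σ.length q v
      have h3 := lengthFrom_le_abs_add (center σ.length) (center (j + 1)) v
      rw [abs_of_nonneg (by linarith [center_mono (show σ.length ≤ j + 1 by omega)])] at h3
      rw [hlen', List.append_assoc]
      push_cast
      linarith
  · refine ⟨p, fun l hl => ?_, fun J hJL hJr ρ hJ hρ => ?_, ?_⟩
    · rw [hlen']
      exact (hpX l hl).trans_lt hj2
    · rw [hlen'] at hρ
      refine hA.1 I J X (by rw [hL, hJL]) (by rw [hr, hJr]) ?_ p hp hpX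
      rw [hdecomp, hJ, hfilter ρ hρ, hfilter]
      intro x hx
      rcases List.mem_append.1 hx with hx | hx
      · obtain ⟨i, h1, h2, rfl⟩ := mem_centers.1 hx
        exact center_mono h1
      · rw [List.mem_singleton.1 hx]
        exact center_mono (by omega)
    · rw [hlen']
      unfold center at hj1 hfin
      push_cast at hfin ⊢
      linarith

theorem exists_ratio (h : Forced A N q σ k) (hA : IsOnlineAlgorithm A) (hq0 : 1 ≤ q) {ε : ℝ}
    (hε0 : 0 < ε) (hε1 : ε ≤ 1) (hqε : 4 ≤ q * ε) (hN : 6 + 3 * q ≤ ε * N)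
    (hσ : 2 * σ.length ≤ N) :
    ∃ I : Inst, I.L = N + 1 ∧ I.r = 1 / 2 ∧ (5 / 4 - ε) * optLength I ≤ trajLength (A I) := by
  obtain ⟨d, hd⟩ : ∃ d, d = N - σ.length := ⟨_, rfl⟩
  induction d using Nat.strong_induction_on generalizing σ k with
  | _ d ih =>
    have hNq : 6 + 3 * q ≤ N := by
      have : (6 + 3 * q : ℝ) ≤ N := hN.trans (by nlinarith [Nat.cast_nonneg (α := ℝ) N])
      exact_mod_cast this
    have hq : σ.length + q < N := by omega
    have hN2 : center (N - 2) = N - 3 / 2 := by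
      unfold center
      rw [Nat.cast_sub (by omega), Nat.cast_ofNat]
      ring
    obtain ⟨I, hL, hr, hI⟩ := exists_inst h.sorted h.nonneg h.lt_center hq
    obtain ⟨p, hp, X, hX, hpX, hfin, hlen⟩ := h.exists_return hA hq0 hq hL hr hI
    have hlen_center : ∀ τ : List ℝ, center (τ.length + 1) = τ.length + 3 / 2 := fun τ => by
      unfold center
      push_cast
      ring
    rcases le_or_gt (center (N - 2)) X with hXN | hXN
    · refine ⟨I, hL, hr, ?_⟩
      have h1 : _ ≤ trajLength (A I) := lengthFrom_le_of_prefix 0 hp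
      have h2 := h.optLength_le hq hL hr hI
      have h3 : (q * k : ℝ) ≤ σ.length := by exact_mod_cast h.mul_le
      have h4 : (2 * σ.length : ℝ) ≤ N := by exact_mod_cast hσ
      have h5 : (4 * k : ℝ) ≤ ε * (q * k) := by
        have := mul_le_mul_of_nonneg_right hqε (Nat.cast_nonneg (α := ℝ) k)
        linarith
      have h6 : 0 ≤ ε * (q * k : ℝ) := by positivity
      have h7 : 0 ≤ ε * (q : ℝ) := by positivity
      have h8 : (5 / 4 - ε) * optLength I ≤ (5 / 4 - ε) * (center N + 2 * (q * (k + 1))) :=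
        mul_le_mul_of_nonneg_left h2 (by linarith)
      rw [hlen_center] at hfin
      unfold center at h8
      linarith
    · obtain ⟨σ', h1, h2, h3⟩ := h.extend hA hq0 hq hL hr hI hp hX hXN hpX hfin hlen
      rcases le_or_gt (2 * σ'.length) N with h4 | h4
      · exact ih _ (by omega) h3 h4 rfl
      · have hq' : σ'.length + (N - 1 - σ'.length) < N := by omega
        obtain ⟨J, hJL, hJr, hJ⟩ := exists_inst h3.sorted h3.nonneg h3.lt_center hq'
        obtain ⟨p', hp', X', hX', -, hfin', hlen'⟩ :=
          h3.exists_return hA (by omega) hq' hJL hJr hJ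
        refine ⟨J, hJL, hJr, ?_⟩
        have h5 : _ ≤ trajLength (A J) := lengthFrom_le_of_prefix 0 hp'
        have h6 := optLength_le_two_mul J
        rw [hJL, hJr] at h6
        have h7 := (center_mono (show N - 2 ≤ σ'.length + (N - 1 - σ'.length) by omega)).trans hX'
        have h8 : ((q : ℝ) * (k + 1 : ℕ)) ≤ σ'.length := by exact_mod_cast h3.mul_le
        have h9 : (N : ℝ) ≤ 2 * σ'.length := by exact_mod_cast h4.le
        have h10 : (σ'.length : ℝ) ≤ N := by exact_mod_cast (show σ'.length ≤ N by omega)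
        have h11 : 4 * ((k + 1 : ℕ) : ℝ) ≤ ε * N := by
          have h12 := mul_le_mul_of_nonneg_right hqε (Nat.cast_nonneg (α := ℝ) (k + 1))
          have h13 := mul_le_mul_of_nonneg_left (h8.trans h10) hε0.le
          linarith
        have h12 : (5 / 4 - ε) * optLength J ≤ (5 / 4 - ε) * (2 * (N + 1 - 1 / 2)) :=
          mul_le_mul_of_nonneg_left h6 (by linarith)
        rw [hlen_center] at hfin'
        have h13 : (0 : ℝ) ≤ q := Nat.cast_nonneg _
        linarith

end Forced

theorem exists_ratio_of_isOnlineAlgorithm {A : Inst → List Leg} (hA : IsOnlineAlgorithm A)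
    {ε : ℝ} (hε : 0 < ε) {δ : ℝ} (hδ : 0 < δ) :
    ∃ I : Inst, I.r ≤ δ * I.L ∧ (5 / 4 - ε) * optLength I ≤ trajLength (A I) := by
  set η := min ε 1 with hη
  have hη0 : 0 < η := lt_min hε one_pos
  obtain ⟨q, hq⟩ := exists_nat_ge (4 / η)
  obtain ⟨N, hN⟩ := exists_nat_ge (max ((6 + 3 * q) / η) (1 / δ))
  have hq' : 4 ≤ q * η := (div_le_iff₀ hη0).1 hq
  have hN1 := (div_le_iff₀ hη0).1 ((le_max_left _ _).trans hN)
  have hN2 := (div_le_iff₀ hδ).1 ((le_max_right _ _).trans hN)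
  have hq1 : 1 ≤ q := by
    rcases Nat.eq_zero_or_pos q with rfl | h
    · norm_num at hq'
    · exact h
  obtain ⟨I, hL, hr, h⟩ := (forced_nil A N q).exists_ratio hA hq1 hη0 (min_le_right _ _) hq'
    (by linarith) (by simp)
  refine ⟨I, by rw [hL, hr]; linarith, le_trans ?_ h⟩
  exact mul_le_mul_of_nonneg_right (by linarith [min_le_left ε 1]) (optLength_nonneg I)

end BarrierCoverage

open BarrierCoverage
theorem mainTheorem5 :
    IsOnlineAlgorithm adaptiveOnline ∧
    (∀ I : Inst, trajLength (adaptiveOnline I) ≤ 5 / 4 * optLength I + 3 / 4 * I.r) ∧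
    (∀ A : Inst → List Leg, IsOnlineAlgorithm A →
      ∀ ε : ℝ, 0 < ε → ∀ δ : ℝ, 0 < δ →
        ∃ I : Inst, I.r ≤ δ * I.L ∧ (5 / 4 - ε) * optLength I ≤ trajLength (A I)) := by
  exact ⟨isOnlineAlgorithm_adaptiveOnline, length_adaptiveOnline_le_optLength,
    fun _ hA _ hε _ hδ => exists_ratio_of_isOnlineAlgorithm hA hε hδ⟩
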